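/- Let $K:\mathbb R^d\to\mathbb R^m$ be linear with operator norm $L=\|K\|$, let $f:\mathbb R^m\to\mathbb R\cup\{\infty\}$ and $g:\mathbb R^d\to\mathbb R\cup\{\infty\}$ be convex, lower semicontinuous and not identically $\infty$, let $f^*(y)=\sup_x\{\langle x,y\rangle-f(x)\}$ and $\operatorname{prox}_{\gamma\varphi}=(\mathrm{id}+\gamma\,\partial\varphi)^{-1}$. For $\tau,\sigma,\theta>0$ and $(X^0,Y^0)\sim\pi_0$, $X_\theta^0=X^0$, consider, with i.i.d. $\xi^{n}\sim N(0,I_d)$ independent of $(X^0,Y^0)$, the modified unadjusted Langevin primal-dual algorithm (ULPDA) $$Y^{n+1}=\operatorname{prox}_{\sigma f^*}(Y^n+\sigma KX^n_\theta),\quad X^{n+1}=\operatorname{prox}_{\tau g}\bigl(X^n-\tau K^TY^{n+1}+\sqrt{2\tau}\,\xi^{n+1}\bigr),\quad X_\theta^{n+1}=X^{n+1}+\theta(X^{n+1}-X^n).$$ (The unmodified ULPDA has $X^{n+1}=\operatorname{prox}_{\tau g}(X^n-\tau K^TY^{n+1})+\sqrt{2\tau}\,\xi^{n+1}$ instead.)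 Let $\pi_n$ be the law of $(X^n,Y^n)$ and $\mu_n$ that of $X^n$; let $\tilde\pi_n,\tilde\mu_n$ be those for the initial law $\tilde\pi_0$. Let $\lambda=\sigma/\tau$, let $\mathcal W_2$ be the 2-Wasserstein distance and, for $a,b>0$, $$\mathcal T_{a,b}(\pi,\tilde\pi)=\inf_{M}\Bigl(\mathbb E_{((x,y),(\tilde x,\tilde y))\sim M}\bigl[a\|x-\tilde x\|^2+b\|y-\tilde y\|^2\bigr]\Bigr)^{1/2},$$ the infimum being over all couplings $M$ of $\pi$ and $\tilde\pi$. A probability measure on $\mathbb R^d\times\mathbb R^m$ is called stationary for the algorithm if it is the law of $(X,Y)$ for some invariant law of the Markov chain $(X^n,X^n_\theta,Y^n)$. Then the following hold. (1) If $\theta=1$ and $\tau\sigma L^2\le1$, then $\mathcal W_2(\mu_N,\tilde\mu_N)\le\mathcal T_{1,\lambda^{-1}}(\pi_0,\tilde\pi_0)$ for all $N\ge0$; and if $\tau\sigma L^2<1$, then $\mathcal T_{1,\lambda^{-1}}(\pi_N,\tilde\pi_N)\le(1-\tau\sigma L^2)^{-1/2}\,\mathcal T_{1,\lambda^{-1}}(\pi_0,\tilde\pi_0)$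 for all $N\ge0$. (2) Let $g$ and $f^*$ be $\omega_g$- and $\omega_{f^*}$-strongly convex with $\omega_g,\omega_{f^*}>0$, let $\max\{(1+2\omega_g\tau)^{-1},(1+2\omega_{f^*}\sigma)^{-1}\}\le\theta<1$ and $\theta\sigma\tau L^2\le1$, and put $\tilde\lambda=\frac{1+2\omega_g\tau}{1+2\omega_{f^*}\sigma}\lambda$. Then $\mathcal W_2(\mu_N,\tilde\mu_N)\le\theta^{N/2}\,\mathcal T_{1,\tilde\lambda^{-1}}(\pi_0,\tilde\pi_0)$ for all $N\ge0$. If $\theta\sigma\tau L^2<1$, then moreover $\mathcal T_{1,\tilde\lambda^{-1}}(\pi_N,\tilde\pi_N)\le(1-\theta\tau\sigma L^2)^{-1/2}\theta^{N/2}\,\mathcal T_{1,\tilde\lambda^{-1}}(\pi_0,\tilde\pi_0)$ for all $N\ge0$, and there is exactly one stationary distribution; it has finite second moment, and $\pi_N$ converges to it in $\mathcal T_{1,\tilde\lambda^{-1}}$ as $N\to\infty$ for every $\pi_0$ with finite second moment. (3) The stationary distribution may differ from that of the unmodified ULPDA: for all $d\ge1$, $m\ge0$, $K$, $\tau,\sigma,\omega_g,\omega_{f^*}>0$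 and $\theta$ that satisfy the conditions of (2) with $\theta\sigma\tau L^2<1$, there are $f,g$ as in (2) with $0<\int_{\mathbb R^d}e^{-f(Kx)-g(x)}\,dx<\infty$ such that each of the two algorithms has exactly one stationary distribution and these two distributions are different. -/

import Mathlib

open MeasureTheory ProbabilityTheory Filter Topology
open scoped ENNReal InnerProductSpace

noncomputable section

namespace ULPDA

section Convex

variable {E : Type*} [NormedAddCommGroup E] [InnerProductSpace ℝ E]

/-- `ω`-strong convexity of an extended-real-valued function (for functions that never take the
value `-∞`; the value `+∞` is allowed). For `ω = 0` this is convexity. -/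
def IsStronglyConvex (ω : ℝ) (φ : E → EReal) : Prop :=
  ∀ x y : E, ∀ a b : ℝ, 0 < a → 0 < b → a + b = 1 →
    φ (a • x + b • y) + ((ω / 2 * a * b * ‖x - y‖ ^ 2 : ℝ) : EReal)
      ≤ (a : EReal) * φ x + (b : EReal) * φ y

/-- Convexity of an extended-real-valued function. -/
def IsConvex (φ : E → EReal) : Prop :=
  ∀ x y : E, ∀ a b : ℝ, 0 < a → 0 < b → a + b = 1 →
    φ (a • x + b • y) ≤ (a : EReal) * φ x + (b : EReal) * φ y

/-- A potential term: a function with values in `ℝ ∪ {∞}`, not identically `∞`, convex and lower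
semicontinuous. -/
structure IsPotential (φ : E → EReal) : Prop where
  ne_bot : ∀ x, φ x ≠ ⊥
  proper : ∃ x, φ x ≠ ⊤
  convex : IsConvex φ
  lsc : LowerSemicontinuous φ

/-- The convex conjugate `f^*(y) = sup_x (⟨x, y⟩ - f x)`. -/
def conj (f : E → EReal) (y : E) : EReal :=
  ⨆ x : E, ((⟪x, y⟫_ℝ : ℝ) : EReal) - f x

/-- The subdifferential `∂φ(x)`. -/
def subdifferential (φ : E → EReal) (x : E) : Set E :=
  {p | ∀ y : E, φ x + ((⟪p, y - x⟫_ℝ : ℝ) : EReal) ≤ φ y}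

/-- The proximal mapping `prox_{γφ}(z) = (id + γ ∂φ)⁻¹(z)`: the (for a potential `φ` and `γ > 0`
unique) point `x` with `z ∈ x + γ ∂φ(x)`. -/
def prox (γ : ℝ) (φ : E → EReal) (z : E) : E :=
  Classical.epsilon fun x => ∃ p ∈ subdifferential φ x, z = x + γ • p

end Convex

section Transport

/-- The couplings of `μ` and `ν`. -/
def couplings {E : Type*} [MeasurableSpace E] (μ ν : Measure E) : Set (Measure (E × E)) :=
  {M | M.map Prod.fst = μ ∧ M.map Prod.snd = ν}

/-- The transport distance `inf_M (𝔼_{(x, x') ∼ M} |x - x'|²)^{1/2}` for a given norm `nrm`,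
with value `∞` if no coupling has finite cost. -/
def transportDist {E : Type*} [MeasurableSpace E] [AddGroup E] (nrm : E → ℝ)
    (μ ν : Measure E) : ℝ≥0∞ :=
  (⨅ M ∈ couplings μ ν, ∫⁻ p, ENNReal.ofReal (nrm (p.1 - p.2) ^ 2) ∂M) ^ (1 / 2 : ℝ)

/-- The 2-Wasserstein distance. -/
def W2 {E : Type*} [NormedAddCommGroup E] [MeasurableSpace E] (μ ν : Measure E) : ℝ≥0∞ :=
  transportDist (fun x : E => ‖x‖) μ ν

/-- The weighted norm `(a |x|² + b |y|²)^{1/2}` on a product space. -/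
def weightedNorm {E F : Type*} [NormedAddCommGroup E] [NormedAddCommGroup F] (a b : ℝ)
    (z : E × F) : ℝ :=
  Real.sqrt (a * ‖z.1‖ ^ 2 + b * ‖z.2‖ ^ 2)

/-- The transport distance `𝒯_{a,b}` induced by the weighted norm. -/
def T {E F : Type*} [NormedAddCommGroup E] [NormedAddCommGroup F] [MeasurableSpace E]
    [MeasurableSpace F] (a b : ℝ) (π ν : Measure (E × F)) : ℝ≥0∞ :=
  transportDist (weightedNorm a b) π ν

end Transport

section Algorithm

/-- The primal space `ℝ^d`. -/
abbrev Primal (d : ℕ) := EuclideanSpace ℝ (Fin d)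

/-- The dual space `ℝ^m`. -/
abbrev Dual (m : ℕ) := EuclideanSpace ℝ (Fin m)

variable {d m : ℕ}

/-- One iteration `(Xⁿ, X_θⁿ, Yⁿ) ↦ (Xⁿ⁺¹, X_θⁿ⁺¹, Yⁿ⁺¹)` of a primal-dual scheme in which
`primal v ξ` is the primal update at `v = Xⁿ - τ Kᵀ Yⁿ⁺¹` with noise `ξ`. -/
def pdStep (primal : Primal d → Primal d → Primal d) (f : Dual m → EReal)
    (K : Primal d →L[ℝ] Dual m) (τ σ θ : ℝ) (s : Primal d × Primal d × Dual m) (ξ : Primal d) :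
    Primal d × Primal d × Dual m :=
  let y := prox σ (conj f) (s.2.2 + σ • K s.2.1)
  let x := primal (s.1 - τ • (ContinuousLinearMap.adjoint K) y) ξ
  (x, x + θ • (x - s.1), y)

/-- The ULPDA iteration, with the noise added after the primal proximal map. -/
def ulpdaStep (f : Dual m → EReal) (g : Primal d → EReal) (K : Primal d →L[ℝ] Dual m)
    (τ σ θ : ℝ) : Primal d × Primal d × Dual m → Primal d → Primal d × Primal d × Dual m :=
  pdStep (fun v ξ => prox τ g v + Real.sqrt (2 * τ) • ξ) f K τ σ θ

/-- The modified iteration, with the noise added inside the primal proximal map. -/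
def modifiedStep (f : Dual m → EReal) (g : Primal d → EReal) (K : Primal d →L[ℝ] Dual m)
    (τ σ θ : ℝ) : Primal d × Primal d × Dual m → Primal d → Primal d × Primal d × Dual m :=
  pdStep (fun v ξ => prox τ g (v + Real.sqrt (2 * τ) • ξ)) f K τ σ θ

/-- The states `(Xⁿ, X_θⁿ, Yⁿ)` generated by an iteration from `z₀ = (X⁰, Y⁰)`, with `X_θ⁰ = X⁰`;
`ξ n` is the noise `ξⁿ⁺¹` used in the step from `n` to `n + 1`. -/
def states {Ω : Type*}
    (step : Primal d × Primal d × Dual m → Primal d → Primal d × Primal d × Dual m)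
    (z₀ : Ω → Primal d × Dual m) (ξ : ℕ → Ω → Primal d) :
    ℕ → Ω → Primal d × Primal d × Dual m
  | 0, w => ((z₀ w).1, (z₀ w).1, (z₀ w).2)
  | n + 1, w => step (states step z₀ ξ n w) (ξ n w)

/-- The iterates `(Xⁿ, Yⁿ)`. -/
def iterates {Ω : Type*}
    (step : Primal d × Primal d × Dual m → Primal d → Primal d × Primal d × Dual m)
    (z₀ : Ω → Primal d × Dual m) (ξ : ℕ → Ω → Primal d) (n : ℕ) (w : Ω) :
    Primal d × Dual m :=
  ((states step z₀ ξ n w).1, (states step z₀ ξ n w).2.2)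

/-- `z₀` is a random initial value and `ξ` an independent sequence of i.i.d. standard Gaussian
vectors. -/
structure IsInput {Ω : Type*} [MeasurableSpace Ω] (P : Measure Ω)
    (z₀ : Ω → Primal d × Dual m) (ξ : ℕ → Ω → Primal d) : Prop where
  measurable_init : Measurable z₀
  measurable_noise : ∀ n, Measurable (ξ n)
  noise_law : ∀ n, P.map (ξ n) = stdGaussian (Primal d)
  noise_indep : iIndepFun ξ P
  init_indep : IndepFun z₀ (fun w n => ξ n w) P

/-- `π` is a stationary distribution of the primal-dual variable `(Xⁿ, Yⁿ)`. As the Markov chain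
is formed by `(Xⁿ, X_θⁿ, Yⁿ)`, this means that `π` is the law of `(X, Y)` for some law of
`(X, X_θ, Y)` that is preserved by a step with independent Gaussian noise. -/
def IsStationaryLaw
    (step : Primal d × Primal d × Dual m → Primal d → Primal d × Primal d × Dual m)
    (π : Measure (Primal d × Dual m)) : Prop :=
  ∃ ρ : Measure (Primal d × Primal d × Dual m), IsProbabilityMeasure ρ ∧
    (ρ.prod (stdGaussian (Primal d))).map (fun p => step p.1 p.2) = ρ ∧
    ρ.map (fun s => (s.1, s.2.2)) = π

end Algorithm

end ULPDA

end

open ULPDA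

namespace ULPDA

section ConvexAnalysis

variable {E : Type*} [NormedAddCommGroup E] [InnerProductSpace ℝ E]

lemma exists_real_of_ne {a : EReal} (hb : a ≠ ⊥) (ht : a ≠ ⊤) : ∃ r : ℝ, a = r :=
  ⟨a.toReal, (EReal.coe_toReal ht hb).symm⟩

lemma IsConvex.isStronglyConvex_zero {φ : E → EReal} (h : IsConvex φ) : IsStronglyConvex 0 φ := by
  intro x y a b ha hb hab
  simpa using h x y a b ha hb hab

lemma ne_top_of_mem_subdifferential {φ : E → EReal} (hφ : ∃ x, φ x ≠ ⊤) {x p : E}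
    (hp : p ∈ subdifferential φ x) : φ x ≠ ⊤ := by
  intro h
  obtain ⟨y, hy⟩ := hφ
  have := hp y
  rw [h, EReal.top_add_coe] at this
  exact hy (top_le_iff.mp this)

lemma IsStronglyConvex.add_le_of_mem_subdifferential {φ : E → EReal} {ω : ℝ}
    (hω : IsStronglyConvex ω φ) {x y p : E} {r s : ℝ} (hr : φ x = r) (hs : φ y = s)
    (hp : p ∈ subdifferential φ x) : r + ⟪p, y - x⟫_ℝ + ω / 2 * ‖x - y‖ ^ 2 ≤ s := by
  have key : ∀ a : ℝ, a ∈ Set.Ioo (0 : ℝ) 1 →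
      r + ⟪p, y - x⟫_ℝ + a * (ω / 2 * ‖x - y‖ ^ 2) ≤ s := by
    intro a ⟨ha, ha1⟩
    have h1 := hω x y a (1 - a) ha (by linarith) (by ring)
    have h2 := hp (a • x + (1 - a) • y)
    have e : a • x + (1 - a) • y - x = (1 - a) • (y - x) := by module
    rw [e, real_inner_smul_right, hr] at h2
    have h3 := (add_le_add_left h2 ((ω / 2 * a * (1 - a) * ‖x - y‖ ^ 2 : ℝ) : EReal)).trans h1
    rw [hr, hs] at h3
    norm_cast at h3
    have h4 : (1 - a) * (r + ⟪p, y - x⟫_ℝ + a * (ω / 2 * ‖x - y‖ ^ 2)) ≤ (1 - a) * s := by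
      linarith
    exact le_of_mul_le_mul_left h4 (by linarith)
  have hlim : Tendsto (fun a : ℝ => r + ⟪p, y - x⟫_ℝ + a * (ω / 2 * ‖x - y‖ ^ 2)) (𝓝[<] 1)
      (𝓝 (r + ⟪p, y - x⟫_ℝ + 1 * (ω / 2 * ‖x - y‖ ^ 2))) :=
    ((continuous_const.add (continuous_id.mul continuous_const)).tendsto 1).mono_left
      nhdsWithin_le_nhds
  rw [one_mul] at hlim
  refine le_of_tendsto hlim ?_
  filter_upwards [Ioo_mem_nhdsLT (zero_lt_one' ℝ)] with a ha using key a ha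

/-- Strong monotonicity of the subdifferential of a strongly convex function. -/
lemma IsStronglyConvex.subdifferential_monotone {φ : E → EReal} {ω : ℝ}
    (hω : IsStronglyConvex ω φ) (hb : ∀ x, φ x ≠ ⊥) (ht : ∃ x, φ x ≠ ⊤) {x y p q : E}
    (hp : p ∈ subdifferential φ x) (hq : q ∈ subdifferential φ y) :
    ω * ‖x - y‖ ^ 2 ≤ ⟪p - q, x - y⟫_ℝ := by
  obtain ⟨r, hr⟩ := exists_real_of_ne (hb x) (ne_top_of_mem_subdifferential ht hp)
  obtain ⟨s, hs⟩ := exists_real_of_ne (hb y) (ne_top_of_mem_subdifferential ht hq)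
  have h1 := hω.add_le_of_mem_subdifferential hr hs hp
  have h2 := hω.add_le_of_mem_subdifferential hs hr hq
  rw [norm_sub_rev y x] at h2
  have e : ⟪p - q, x - y⟫_ℝ = -(⟪p, y - x⟫_ℝ + ⟪q, x - y⟫_ℝ) := by
    rw [inner_sub_left, ← neg_sub y x, inner_neg_right, inner_neg_right]; ring
  rw [e]; linarith

lemma IsPotential.exists_linear_lower_bound [FiniteDimensional ℝ E] {φ : E → EReal}
    (hφ : IsPotential φ) {x₀ : E} {r : ℝ} (hr : φ x₀ = r) :
    ∃ A : ℝ, 0 ≤ A ∧ ∀ x, ((r - A * (1 + ‖x - x₀‖) : ℝ) : EReal) ≤ φ x := by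
  have : ProperSpace E := FiniteDimensional.proper ℝ E
  obtain ⟨q, -, hq⟩ := (hφ.lsc.lowerSemicontinuousOn (Metric.closedBall x₀ 1)).exists_isMinOn
    ⟨x₀, Metric.mem_closedBall_self zero_le_one⟩ (isCompact_closedBall x₀ 1)
  have hqle : ∀ x ∈ Metric.closedBall x₀ 1, φ q ≤ φ x := fun x hx => hq hx
  have h0 := hqle x₀ (Metric.mem_closedBall_self zero_le_one)
  obtain ⟨c, hc⟩ := exists_real_of_ne (hφ.ne_bot q)
    (fun h => by rw [h, hr] at h0; exact EReal.coe_ne_top r (top_le_iff.mp h0))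
  rw [hc] at hqle h0
  rw [hr] at h0
  have hcr : c ≤ r := by exact_mod_cast h0
  refine ⟨r - c, by linarith, fun x => ?_⟩
  by_cases hx : ‖x - x₀‖ ≤ 1
  · refine le_trans ?_ (hqle x (by rwa [mem_closedBall_iff_norm]))
    norm_cast
    nlinarith [norm_nonneg (x - x₀)]
  push Not at hx
  by_cases hxt : φ x = ⊤
  · rw [hxt]; exact le_top
  obtain ⟨s, hs⟩ := exists_real_of_ne (hφ.ne_bot x) hxt
  set ρ := ‖x - x₀‖ with hρ
  have hρ0 : 0 < ρ := by linarith
  have h1 := hφ.convex x₀ x (1 - ρ⁻¹) ρ⁻¹ (by rw [sub_pos]; exact inv_lt_one_of_one_lt₀ hx)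
    (by positivity) (by ring)
  have h2 := (hqle ((1 - ρ⁻¹) • x₀ + ρ⁻¹ • x) (by
    rw [mem_closedBall_iff_norm]
    have e : (1 - ρ⁻¹) • x₀ + ρ⁻¹ • x - x₀ = ρ⁻¹ • (x - x₀) := by module
    rw [e, norm_smul, norm_inv, norm_norm, ← hρ, inv_mul_cancel₀ hρ0.ne'])).trans h1
  rw [hr, hs] at h2
  norm_cast at h2
  rw [hs]
  norm_cast
  have h3 : ρ * c ≤ ρ * ((1 - ρ⁻¹) * r + ρ⁻¹ * s) := mul_le_mul_of_nonneg_left h2 hρ0.le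
  have e : ρ * ((1 - ρ⁻¹) * r + ρ⁻¹ * s) = (ρ - 1) * r + s := by field_simp
  rw [e] at h3
  nlinarith

lemma IsPotential.exists_proximal_minimizer [FiniteDimensional ℝ E] {φ : E → EReal}
    (hφ : IsPotential φ) {γ : ℝ} (hγ : 0 < γ) (z : E) :
    ∃ p, ∀ y, φ p + ((‖p - z‖ ^ 2 / (2 * γ) : ℝ) : EReal)
      ≤ φ y + ((‖y - z‖ ^ 2 / (2 * γ) : ℝ) : EReal) := by
  have : ProperSpace E := FiniteDimensional.proper ℝ E
  obtain ⟨x₀, hx₀⟩ := hφ.proper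
  obtain ⟨r, hr⟩ := exists_real_of_ne (hφ.ne_bot x₀) hx₀
  obtain ⟨A, hA, hlow⟩ := hφ.exists_linear_lower_bound hr
  set D := ‖x₀ - z‖ with hD
  have hD0 : 0 ≤ D := norm_nonneg _
  set R := 2 * D + 4 * γ * A + 1 with hR
  have hR0 : 1 ≤ R := by rw [hR]; nlinarith [mul_nonneg hγ.le hA]
  have hlsc : LowerSemicontinuous
      (fun x => φ x + ((‖x - z‖ ^ 2 / (2 * γ) : ℝ) : EReal)) := by
    refine LowerSemicontinuous.add' hφ.lsc (Continuous.lowerSemicontinuous ?_) ?_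
    · exact continuous_coe_real_ereal.comp (by fun_prop)
    · intro x
      exact EReal.continuousAt_add (Or.inr (EReal.coe_ne_bot _)) (Or.inl (hφ.ne_bot x))
  have hmem : x₀ ∈ Metric.closedBall x₀ R := Metric.mem_closedBall_self (by linarith)
  obtain ⟨p, -, hp⟩ := (hlsc.lowerSemicontinuousOn (Metric.closedBall x₀ R)).exists_isMinOn
    ⟨x₀, hmem⟩ (isCompact_closedBall x₀ R)
  refine ⟨p, fun y => ?_⟩
  by_cases hy : y ∈ Metric.closedBall x₀ R
  · exact hp hy
  refine (hp hmem : _ ≤ _).trans ?_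
  refine le_trans ?_ (add_le_add_left (hlow y) _)
  rw [mem_closedBall_iff_norm, not_le] at hy
  dsimp only
  rw [hr]
  norm_cast
  set ρ := ‖y - x₀‖ with hρ
  have h1 : ρ - D ≤ ‖y - z‖ := by
    have := norm_sub_le (y - z) (x₀ - z)
    rw [sub_sub_sub_cancel_right] at this
    linarith
  have h2 : (ρ - D) ^ 2 ≤ ‖y - z‖ ^ 2 := by
    have : 0 ≤ ρ - D := by nlinarith [mul_nonneg hγ.le hA]
    gcongr
  have h3 : D ^ 2 + 2 * γ * (A * (1 + ρ)) ≤ ‖y - z‖ ^ 2 := by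
    have hγA := mul_nonneg hγ.le hA
    nlinarith [mul_nonneg (by linarith : (0:ℝ) ≤ ρ) (by linarith : (0:ℝ) ≤ ρ - R)]
  have h4 : D ^ 2 / (2 * γ) + A * (1 + ρ) ≤ ‖y - z‖ ^ 2 / (2 * γ) := by
    rw [le_div_iff₀ (by positivity), add_mul, div_mul_cancel₀ _ (by positivity)]
    linarith
  linarith

lemma IsPotential.exists_resolvent [FiniteDimensional ℝ E] {φ : E → EReal}
    (hφ : IsPotential φ) {γ : ℝ} (hγ : 0 < γ) (z : E) :
    ∃ x, ∃ p ∈ subdifferential φ x, z = x + γ • p := by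
  obtain ⟨x, hx⟩ := hφ.exists_proximal_minimizer hγ z
  have hxt : φ x ≠ ⊤ := by
    intro h
    obtain ⟨y, hy⟩ := hφ.proper
    obtain ⟨s, hs⟩ := exists_real_of_ne (hφ.ne_bot y) hy
    have := hx y
    rw [h, hs, EReal.top_add_coe, ← EReal.coe_add] at this
    exact EReal.coe_ne_top _ (top_le_iff.mp this)
  obtain ⟨r, hr⟩ := exists_real_of_ne (hφ.ne_bot x) hxt
  refine ⟨x, γ⁻¹ • (z - x), fun y => ?_, by rw [smul_inv_smul₀ hγ.ne']; abel⟩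
  by_cases hyt : φ y = ⊤
  · rw [hyt]; exact le_top
  obtain ⟨s, hs⟩ := exists_real_of_ne (hφ.ne_bot y) hyt
  rw [hr, hs]
  norm_cast
  rw [real_inner_smul_left]
  have key : ∀ t : ℝ, t ∈ Set.Ioo (0 : ℝ) 1 →
      r + γ⁻¹ * ⟪z - x, y - x⟫_ℝ - t * (‖y - x‖ ^ 2 / (2 * γ)) ≤ s := by
    intro t ⟨ht, ht1⟩
    have h1 := hφ.convex x y (1 - t) t (by linarith) ht (by ring)
    have h2 := (hx ((1 - t) • x + t • y)).trans (add_le_add_left h1 _)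
    rw [hr, hs] at h2
    norm_cast at h2
    have e : (1 - t) • x + t • y - z = (x - z) + t • (y - x) := by module
    rw [e, norm_add_sq_real, real_inner_smul_right, norm_smul, ← neg_sub z x, inner_neg_left,
      norm_neg, Real.norm_of_nonneg ht.le] at h2
    have e2 : (‖z - x‖ ^ 2 + 2 * (t * -⟪z - x, y - x⟫_ℝ) + (t * ‖y - x‖) ^ 2) / (2 * γ)
        = ‖z - x‖ ^ 2 / (2 * γ) - t * (γ⁻¹ * ⟪z - x, y - x⟫_ℝ - t * (‖y - x‖ ^ 2 / (2 * γ))) := by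
      field_simp; ring
    rw [e2] at h2
    have h3 : t * (r + γ⁻¹ * ⟪z - x, y - x⟫_ℝ - t * (‖y - x‖ ^ 2 / (2 * γ))) ≤ t * s := by
      linarith
    exact le_of_mul_le_mul_left h3 ht
  have hlim : Tendsto (fun t : ℝ => r + γ⁻¹ * ⟪z - x, y - x⟫_ℝ - t * (‖y - x‖ ^ 2 / (2 * γ)))
      (𝓝[>] 0) (𝓝 (r + γ⁻¹ * ⟪z - x, y - x⟫_ℝ - 0 * (‖y - x‖ ^ 2 / (2 * γ)))) :=
    ((continuous_const.sub (continuous_id.mul continuous_const)).tendsto 0).mono_left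
      nhdsWithin_le_nhds
  rw [zero_mul, sub_zero] at hlim
  refine le_of_tendsto hlim ?_
  filter_upwards [Ioo_mem_nhdsGT (zero_lt_one' ℝ)] with t ht using key t ht

lemma IsPotential.prox_spec [FiniteDimensional ℝ E] {φ : E → EReal} (hφ : IsPotential φ) {γ : ℝ}
    (hγ : 0 < γ) (z : E) : ∃ p ∈ subdifferential φ (prox γ φ z), z = prox γ φ z + γ • p :=
  Classical.epsilon_spec (hφ.exists_resolvent hγ z)

lemma IsPotential.monotone_of_resolvent {φ : E → EReal} (hφ : IsPotential φ) {ω γ : ℝ}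
    (hω : IsStronglyConvex ω φ) (hγ : 0 < γ) {x x' z z' : E}
    (h : ∃ p ∈ subdifferential φ x, z = x + γ • p)
    (h' : ∃ p ∈ subdifferential φ x', z' = x' + γ • p) :
    γ * ω * ‖x - x'‖ ^ 2 ≤ ⟪(z - z') - (x - x'), x - x'⟫_ℝ := by
  obtain ⟨p, hp, rfl⟩ := h
  obtain ⟨q, hq, rfl⟩ := h'
  have e : x + γ • p - (x' + γ • q) - (x - x') = γ • (p - q) := by module
  rw [e, real_inner_smul_left, mul_assoc]
  exact mul_le_mul_of_nonneg_left (hω.subdifferential_monotone hφ.ne_bot hφ.proper hp hq) hγ.le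

lemma IsPotential.prox_monotone [FiniteDimensional ℝ E] {φ : E → EReal} (hφ : IsPotential φ)
    {ω γ : ℝ} (hω : IsStronglyConvex ω φ) (hγ : 0 < γ) (z z' : E) :
    γ * ω * ‖prox γ φ z - prox γ φ z'‖ ^ 2
      ≤ ⟪(z - z') - (prox γ φ z - prox γ φ z'), prox γ φ z - prox γ φ z'⟫_ℝ :=
  hφ.monotone_of_resolvent hω hγ (hφ.prox_spec hγ z) (hφ.prox_spec hγ z')

lemma norm_le_of_inner_sub_nonneg {u v : E} (h : 0 ≤ ⟪u - v, v⟫_ℝ) : ‖v‖ ≤ ‖u‖ := by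
  rw [inner_sub_left, real_inner_self_eq_norm_sq] at h
  have h1 := real_inner_le_norm u v
  by_contra! h2
  nlinarith [norm_nonneg u, norm_nonneg v]

lemma IsPotential.norm_prox_sub_le [FiniteDimensional ℝ E] {φ : E → EReal} (hφ : IsPotential φ)
    {γ : ℝ} (hγ : 0 < γ) (z z' : E) : ‖prox γ φ z - prox γ φ z'‖ ≤ ‖z - z'‖ := by
  have h := hφ.prox_monotone hφ.convex.isStronglyConvex_zero hγ z z'
  exact norm_le_of_inner_sub_nonneg (by simpa using h)

lemma IsPotential.continuous_prox [FiniteDimensional ℝ E] {φ : E → EReal} (hφ : IsPotential φ)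
    {γ : ℝ} (hγ : 0 < γ) : Continuous (prox γ φ) :=
  (LipschitzWith.of_dist_le_mul (K := 1) fun z z' => by
    simpa [dist_eq_norm] using hφ.norm_prox_sub_le hγ z z').continuous

lemma IsPotential.prox_eq [FiniteDimensional ℝ E] {φ : E → EReal} (hφ : IsPotential φ)
    {γ : ℝ} (hγ : 0 < γ) {x p z : E} (hp : p ∈ subdifferential φ x) (hz : z = x + γ • p) :
    prox γ φ z = x := by
  have h := hφ.monotone_of_resolvent hφ.convex.isStronglyConvex_zero hγ
    (hφ.prox_spec hγ z) ⟨p, hp, hz⟩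
  rw [mul_zero, zero_mul] at h
  have h2 := norm_le_of_inner_sub_nonneg h
  rw [sub_self, norm_zero] at h2
  exact sub_eq_zero.mp (norm_le_zero_iff.mp h2)

lemma conj_le_iff {f : E → EReal} {y : E} {c : EReal} :
    conj f y ≤ c ↔ ∀ x, ((⟪x, y⟫_ℝ : ℝ) : EReal) - f x ≤ c := iSup_le_iff

lemma le_conj (f : E → EReal) (x y : E) : ((⟪x, y⟫_ℝ : ℝ) : EReal) - f x ≤ conj f y :=
  le_iSup (fun x => ((⟪x, y⟫_ℝ : ℝ) : EReal) - f x) x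

lemma IsPotential.conj_ne_bot {f : E → EReal} (hf : IsPotential f) (y : E) : conj f y ≠ ⊥ := by
  obtain ⟨x₀, hx₀⟩ := hf.proper
  obtain ⟨r, hr⟩ := exists_real_of_ne (hf.ne_bot x₀) hx₀
  intro h
  have := le_conj f x₀ y
  rw [h, hr, ← EReal.coe_sub] at this
  exact EReal.coe_ne_bot _ (le_bot_iff.mp this)

lemma IsPotential.isPotential_conj [FiniteDimensional ℝ E] {f : E → EReal} (hf : IsPotential f) :
    IsPotential (conj f) where
  ne_bot := hf.conj_ne_bot
  proper := by
    obtain ⟨x, p, hp, -⟩ := hf.exists_resolvent zero_lt_one 0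
    obtain ⟨r, hr⟩ := exists_real_of_ne (hf.ne_bot x) (ne_top_of_mem_subdifferential hf.proper hp)
    refine ⟨p, fun h => ?_⟩
    have : conj f p ≤ ((⟪p, x⟫_ℝ - r : ℝ) : EReal) := by
      refine conj_le_iff.mpr fun y => ?_
      by_cases hyt : f y = ⊤
      · rw [hyt, EReal.sub_top]; exact bot_le
      obtain ⟨s, hs⟩ := exists_real_of_ne (hf.ne_bot y) hyt
      have h1 := hp y
      rw [hr, hs] at h1
      rw [hs]
      norm_cast at h1 ⊢
      rw [inner_sub_right] at h1
      rw [real_inner_comm]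
      linarith
    rw [h] at this
    exact EReal.coe_ne_top _ (top_le_iff.mp this)
  convex := by
    intro y y' a b ha hb hab
    refine conj_le_iff.mpr fun x => ?_
    by_cases hxt : f x = ⊤
    · rw [hxt, EReal.sub_top]; exact bot_le
    obtain ⟨s, hs⟩ := exists_real_of_ne (hf.ne_bot x) hxt
    have h1 := mul_le_mul_of_nonneg_left (le_conj f x y) (EReal.coe_nonneg.mpr ha.le)
    have h2 := mul_le_mul_of_nonneg_left (le_conj f x y') (EReal.coe_nonneg.mpr hb.le)
    refine le_trans (le_of_eq ?_) (add_le_add h1 h2)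
    rw [hs, inner_add_right, real_inner_smul_right, real_inner_smul_right]
    norm_cast
    linear_combination (-s) * hab.symm
  lsc := by
    refine lowerSemicontinuous_iSup fun x => ?_
    by_cases hxt : f x = ⊤
    · simp only [hxt, EReal.sub_top]; exact lowerSemicontinuous_const
    obtain ⟨s, hs⟩ := exists_real_of_ne (hf.ne_bot x) hxt
    simp only [hs]
    refine Continuous.lowerSemicontinuous ?_
    simp only [← EReal.coe_sub]
    exact continuous_coe_real_ereal.comp (by fun_prop)

end ConvexAnalysis

section Energy

variable {d m : ℕ}

/-- The weight `(1 + 2 ω γ) / (2 γ)` of a squared distance in the energy of a pair of states, for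
a step size `γ` and a strong convexity modulus `ω`. -/
noncomputable def weight (γ ω : ℝ) : ℝ := (1 + 2 * ω * γ) / (2 * γ)

/-- The conditions on the step sizes `τ`, `σ`, the relaxation parameter `θ`, the strong convexity
moduli and the operator norm `L`. -/
structure Admissible (τ σ θ ωg ωf L : ℝ) : Prop where
  tau_pos : 0 < τ
  sigma_pos : 0 < σ
  theta_pos : 0 < θ
  theta_le : θ ≤ 1
  omega_g_nonneg : 0 ≤ ωg
  omega_f_nonneg : 0 ≤ ωf
  inv_g_le : (1 + 2 * ωg * τ)⁻¹ ≤ θ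
  inv_f_le : (1 + 2 * ωf * σ)⁻¹ ≤ θ
  coupling_le : θ * σ * τ * L ^ 2 ≤ 1

lemma weight_pos {γ ω : ℝ} (hγ : 0 < γ) (hω : 0 ≤ ω) : 0 < weight γ ω := by
  unfold weight; positivity

lemma one_div_le_mul_weight {γ ω θ : ℝ} (hγ : 0 < γ) (hω : 0 ≤ ω)
    (h : (1 + 2 * ω * γ)⁻¹ ≤ θ) : 1 / (2 * γ) ≤ θ * weight γ ω := by
  unfold weight
  rw [inv_le_iff_one_le_mul₀ (by positivity)] at h
  rw [← mul_div_assoc]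
  gcongr

lemma Admissible.half_tau_mul_le {τ σ θ ωg ωf L : ℝ} (h : Admissible τ σ θ ωg ωf L) :
    τ * L ^ 2 / 2 ≤ weight σ ωf * (θ * σ * τ * L ^ 2) := by
  have h1 := one_div_le_mul_weight h.sigma_pos h.omega_f_nonneg h.inv_f_le
  have hσ := h.sigma_pos
  have h2 : (1 / (2 * σ)) * (σ * (τ * L ^ 2)) ≤ (θ * weight σ ωf) * (σ * (τ * L ^ 2)) :=
    mul_le_mul_of_nonneg_right h1 (mul_nonneg hσ.le (mul_nonneg h.tau_pos.le (sq_nonneg L)))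
  have e : (1 / (2 * σ)) * (σ * (τ * L ^ 2)) = τ * L ^ 2 / 2 := by field_simp
  linarith

/-- The energy of the difference `s` of two states of the primal-dual chain. -/
noncomputable def energy (K : Primal d →L[ℝ] Dual m) (τ σ θ ωg ωf : ℝ) (s : Primal d × Primal d × Dual m) : ℝ :=
  weight τ ωg * ‖s.1‖ ^ 2 + weight σ ωf * ‖s.2.2‖ ^ 2
    + ⟪K (θ⁻¹ • (s.2.1 - s.1)), s.2.2⟫_ℝ + ‖θ⁻¹ • (s.2.1 - s.1)‖ ^ 2 / (2 * τ)

lemma energy_diag (K : Primal d →L[ℝ] Dual m) (τ σ θ ωg ωf : ℝ) (x : Primal d) (y : Dual m) :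
    energy K τ σ θ ωg ωf (x, x, y) = weight τ ωg * ‖x‖ ^ 2 + weight σ ωf * ‖y‖ ^ 2 := by
  simp [energy]

lemma continuous_energy (K : Primal d →L[ℝ] Dual m) (τ σ θ ωg ωf : ℝ) :
    Continuous (energy K τ σ θ ωg ωf) := by
  unfold energy; fun_prop

lemma inner_apply_le (K : Primal d →L[ℝ] Dual m) (u : Primal d) (y : Dual m) :
    |⟪K u, y⟫_ℝ| ≤ ‖K‖ * ‖u‖ * ‖y‖ :=
  (abs_real_inner_le_norm _ _).trans
    (mul_le_mul_of_nonneg_right (K.le_opNorm u) (norm_nonneg y))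

lemma Admissible.le_energy {K : Primal d →L[ℝ] Dual m} {τ σ θ ωg ωf : ℝ}
    (h : Admissible τ σ θ ωg ωf ‖K‖) (s : Primal d × Primal d × Dual m) :
    weight τ ωg * ‖s.1‖ ^ 2 + weight σ ωf * (1 - θ * σ * τ * ‖K‖ ^ 2) * ‖s.2.2‖ ^ 2
      ≤ energy K τ σ θ ωg ωf s := by
  unfold energy
  set u := θ⁻¹ • (s.2.1 - s.1)
  have h1 := (abs_le.mp (inner_apply_le K u s.2.2)).1
  have hτ := h.tau_pos
  have h2 := mul_le_mul_of_nonneg_right h.half_tau_mul_le (sq_nonneg ‖s.2.2‖)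
  have h3 : ‖K‖ * ‖u‖ * ‖s.2.2‖ ≤ ‖u‖ ^ 2 / (2 * τ) + τ * ‖K‖ ^ 2 / 2 * ‖s.2.2‖ ^ 2 := by
    have : 0 ≤ (‖u‖ - τ * ‖K‖ * ‖s.2.2‖) ^ 2 / (2 * τ) := by positivity
    have e : (‖u‖ - τ * ‖K‖ * ‖s.2.2‖) ^ 2 / (2 * τ) = ‖u‖ ^ 2 / (2 * τ)
        + τ * ‖K‖ ^ 2 / 2 * ‖s.2.2‖ ^ 2 - ‖K‖ * ‖u‖ * ‖s.2.2‖ := by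
      field_simp; ring
    linarith
  linarith

lemma Admissible.exists_norm_sq_le_energy {K : Primal d →L[ℝ] Dual m} {τ σ θ ωg ωf : ℝ}
    (h : Admissible τ σ θ ωg ωf ‖K‖) (hlt : θ * σ * τ * ‖K‖ ^ 2 < 1) :
    ∃ c : ℝ, 0 < c ∧ ∀ s, c * ‖s‖ ^ 2 ≤ energy K τ σ θ ωg ωf s := by
  have hτ := h.tau_pos
  have hσ := h.sigma_pos
  have hθ := h.theta_pos
  set κ := θ * σ * τ * ‖K‖ ^ 2 with hκ
  have hκ0 : 0 ≤ κ := by positivity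
  set a := weight τ ωg with ha
  set b := weight σ ωf with hb
  have ha0 : 0 < a := weight_pos hτ h.omega_g_nonneg
  have hb0 : 0 < b := weight_pos hσ h.omega_f_nonneg
  set e := (1 + κ) / 2 with he
  have he0 : 0 < e := by positivity
  have he1 : 0 < 1 - e := by rw [he]; linarith
  set c₀ := min a (min ((1 - e) * b) ((1 - e) / (2 * τ))) with hc₀
  have hc₀0 : 0 < c₀ := by rw [hc₀]; positivity
  refine ⟨c₀ / 2, by positivity, fun s => ?_⟩
  unfold energy
  set u := θ⁻¹ • (s.2.1 - s.1) with hu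
  have hx : s.2.1 = s.1 + θ • u := by rw [hu, smul_inv_smul₀ hθ.ne']; abel
  have h1 := (abs_le.mp (inner_apply_le K u s.2.2)).1
  have hhalf := h.half_tau_mul_le
  have h3 : ‖K‖ * ‖u‖ * ‖s.2.2‖ ≤ e * (‖u‖ ^ 2 / (2 * τ)) + e * b * ‖s.2.2‖ ^ 2 := by
    have h4 : 0 ≤ e / (2 * τ) * (‖u‖ - τ * ‖K‖ * ‖s.2.2‖ / e) ^ 2 := by positivity
    have e4 : e / (2 * τ) * (‖u‖ - τ * ‖K‖ * ‖s.2.2‖ / e) ^ 2 = e * (‖u‖ ^ 2 / (2 * τ))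
        + (τ * ‖K‖ ^ 2 / 2) / e * ‖s.2.2‖ ^ 2 - ‖K‖ * ‖u‖ * ‖s.2.2‖ := by
      field_simp; ring
    have h5 : (τ * ‖K‖ ^ 2 / 2) / e ≤ e * b := by
      rw [div_le_iff₀ he0]
      refine hhalf.trans ?_
      have : κ ≤ e * e := by rw [he]; nlinarith [sq_nonneg (1 - κ)]
      nlinarith
    have h6 := mul_le_mul_of_nonneg_right h5 (sq_nonneg ‖s.2.2‖)
    linarith
  have hca : c₀ ≤ a := min_le_left _ _
  have hcb : c₀ ≤ (1 - e) * b := (min_le_right _ _).trans (min_le_left _ _)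
  have hcu : c₀ ≤ (1 - e) / (2 * τ) := (min_le_right _ _).trans (min_le_right _ _)
  have h7 := mul_le_mul_of_nonneg_right hca (sq_nonneg ‖s.1‖)
  have h8 := mul_le_mul_of_nonneg_right hcb (sq_nonneg ‖s.2.2‖)
  have h9 := mul_le_mul_of_nonneg_right hcu (sq_nonneg ‖u‖)
  have e9 : (1 - e) / (2 * τ) * ‖u‖ ^ 2 = (1 - e) * (‖u‖ ^ 2 / (2 * τ)) := by ring
  have h10 : c₀ * (‖s.1‖ ^ 2 + ‖s.2.2‖ ^ 2 + ‖u‖ ^ 2) ≤ a * ‖s.1‖ ^ 2 + b * ‖s.2.2‖ ^ 2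
      + ⟪K u, s.2.2⟫_ℝ + ‖u‖ ^ 2 / (2 * τ) := by linarith
  refine le_trans ?_ h10
  have h11 : ‖s‖ ^ 2 ≤ 2 * (‖s.1‖ ^ 2 + ‖s.2.2‖ ^ 2 + ‖u‖ ^ 2) := by
    have h12 : ‖s.2.1‖ ≤ ‖s.1‖ + ‖u‖ := by
      rw [hx]
      refine (norm_add_le _ _).trans (add_le_add_right ?_ _)
      rw [norm_smul, Real.norm_of_nonneg hθ.le]
      exact mul_le_of_le_one_left (norm_nonneg _) h.theta_le
    have h13 : ‖s.2.1‖ ^ 2 ≤ (‖s.1‖ + ‖u‖) ^ 2 := by gcongr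
    have q1 := sq_nonneg ‖s.1‖
    have q2 := sq_nonneg ‖s.2.2‖
    have q3 := sq_nonneg ‖u‖
    rcases max_cases ‖s.1‖ ‖s.2‖ with ⟨hm, -⟩ | ⟨hm, -⟩ <;> rw [Prod.norm_def, hm]
    · linarith
    · rcases max_cases ‖s.2.1‖ ‖s.2.2‖ with ⟨hm, -⟩ | ⟨hm, -⟩ <;> rw [Prod.norm_def, hm]
      · linarith [add_sq_le (a := ‖s.1‖) (b := ‖u‖)]
      · linarith
  calc c₀ / 2 * ‖s‖ ^ 2 ≤ c₀ / 2 * (2 * (‖s.1‖ ^ 2 + ‖s.2.2‖ ^ 2 + ‖u‖ ^ 2)) := by gcongr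
    _ = _ := by ring

lemma Admissible.exists_energy_le {K : Primal d →L[ℝ] Dual m} {τ σ θ ωg ωf : ℝ}
    (h : Admissible τ σ θ ωg ωf ‖K‖) :
    ∃ C : ℝ, 0 < C ∧ ∀ s, energy K τ σ θ ωg ωf s ≤ C * ‖s‖ ^ 2 := by
  have hτ := h.tau_pos
  have hθ := h.theta_pos
  have ha0 := weight_pos hτ h.omega_g_nonneg
  have hb0 := weight_pos h.sigma_pos h.omega_f_nonneg
  refine ⟨weight τ ωg + weight σ ωf + ‖K‖ * (θ⁻¹ * 2) + (θ⁻¹ * 2) ^ 2 / (2 * τ), by positivity,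
    fun s => ?_⟩
  unfold energy
  set u := θ⁻¹ • (s.2.1 - s.1) with hu
  have hx : ‖s.1‖ ≤ ‖s‖ := norm_fst_le s
  have hy : ‖s.2.2‖ ≤ ‖s‖ := (norm_snd_le s.2).trans (norm_snd_le s)
  have hxt : ‖s.2.1‖ ≤ ‖s‖ := (norm_fst_le s.2).trans (norm_snd_le s)
  have hun : ‖u‖ ≤ θ⁻¹ * 2 * ‖s‖ := by
    rw [hu, norm_smul, norm_inv, Real.norm_of_nonneg hθ.le, mul_assoc]
    gcongr
    linarith [norm_sub_le s.2.1 s.1]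
  have h1 := (abs_le.mp (inner_apply_le K u s.2.2)).2
  have h2 : ‖K‖ * ‖u‖ * ‖s.2.2‖ ≤ ‖K‖ * (θ⁻¹ * 2 * ‖s‖) * ‖s‖ := by gcongr
  have h3 : ‖u‖ ^ 2 / (2 * τ) ≤ (θ⁻¹ * 2 * ‖s‖) ^ 2 / (2 * τ) := by gcongr
  have h4 : weight τ ωg * ‖s.1‖ ^ 2 ≤ weight τ ωg * ‖s‖ ^ 2 := by gcongr
  have h5 : weight σ ωf * ‖s.2.2‖ ^ 2 ≤ weight σ ωf * ‖s‖ ^ 2 := by gcongr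
  have e3 : (θ⁻¹ * 2 * ‖s‖) ^ 2 / (2 * τ) = (θ⁻¹ * 2) ^ 2 / (2 * τ) * ‖s‖ ^ 2 := by ring
  rw [e3] at h3
  nlinarith

lemma Admissible.energy_decrease {K : Primal d →L[ℝ] Dual m} {τ σ θ ωg ωf : ℝ}
    (h : Admissible τ σ θ ωg ωf ‖K‖) {x u x' : Primal d} {y y' : Dual m}
    (hy : σ * ωf * ‖y'‖ ^ 2 ≤ ⟪(y + σ • K (x + θ • u)) - y', y'⟫_ℝ)
    (hx : τ * ωg * ‖x'‖ ^ 2 ≤ ⟪(x - τ • (ContinuousLinearMap.adjoint K) y') - x', x'⟫_ℝ) :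
    weight τ ωg * ‖x'‖ ^ 2 + weight σ ωf * ‖y'‖ ^ 2 + ⟪K (x' - x), y'⟫_ℝ
        + ‖x' - x‖ ^ 2 / (2 * τ)
      ≤ θ * (weight τ ωg * ‖x‖ ^ 2 + weight σ ωf * ‖y‖ ^ 2 + ⟪K u, y⟫_ℝ + ‖u‖ ^ 2 / (2 * τ)) := by
  have hτ := h.tau_pos
  have hσ := h.sigma_pos
  have hθ := h.theta_pos
  have hwx := mul_le_mul_of_nonneg_right
    (one_div_le_mul_weight hτ h.omega_g_nonneg h.inv_g_le) (sq_nonneg ‖x‖)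
  have hwy := mul_le_mul_of_nonneg_right
    (one_div_le_mul_weight hσ h.omega_f_nonneg h.inv_f_le) (sq_nonneg ‖y‖)
  have hcross : θ * ⟪K u, y' - y⟫_ℝ ≤ ‖y' - y‖ ^ 2 / (2 * σ) + θ * (‖u‖ ^ 2 / (2 * τ)) := by
    have h1 := mul_le_mul_of_nonneg_left (abs_le.mp (inner_apply_le K u (y' - y))).2 hθ.le
    have h2 : 0 ≤ (‖y' - y‖ - σ * θ * ‖K‖ * ‖u‖) ^ 2 / (2 * σ) := by positivity
    have e2 : (‖y' - y‖ - σ * θ * ‖K‖ * ‖u‖) ^ 2 / (2 * σ) = ‖y' - y‖ ^ 2 / (2 * σ)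
        + (θ * σ * τ * ‖K‖ ^ 2) * (θ * (‖u‖ ^ 2 / (2 * τ)))
        - θ * (‖K‖ * ‖u‖ * ‖y' - y‖) := by
      field_simp; ring
    have h3 := mul_le_mul_of_nonneg_right h.coupling_le
      (by positivity : 0 ≤ θ * (‖u‖ ^ 2 / (2 * τ)))
    linarith
  rw [inner_sub_right] at hcross
  rw [inner_sub_left, inner_add_left, real_inner_smul_left, map_add, map_smul, inner_add_left,
    real_inner_smul_left, real_inner_self_eq_norm_sq] at hy
  rw [inner_sub_left, inner_sub_left, real_inner_smul_left, ContinuousLinearMap.adjoint_inner_left,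
    real_inner_self_eq_norm_sq, real_inner_comm (K x')] at hx
  rw [norm_sub_sq_real, real_inner_comm y y'] at hcross
  rw [map_sub, inner_sub_left, norm_sub_sq_real, real_inner_comm x x']
  have hy2 : weight σ ωf * ‖y'‖ ^ 2 ≤ 1 / (2 * σ) * ‖y‖ ^ 2
      - (‖y'‖ ^ 2 - 2 * ⟪y, y'⟫_ℝ + ‖y‖ ^ 2) / (2 * σ) + (⟪K x, y'⟫_ℝ + θ * ⟪K u, y'⟫_ℝ) := by
    have h1 := div_le_div_of_nonneg_right hy hσ.le
    have e1 : σ * ωf * ‖y'‖ ^ 2 / σ = weight σ ωf * ‖y'‖ ^ 2 - ‖y'‖ ^ 2 / (2 * σ) := by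
      unfold weight; field_simp; ring
    have e2 : (⟪y, y'⟫_ℝ + σ * (⟪K x, y'⟫_ℝ + θ * ⟪K u, y'⟫_ℝ) - ‖y'‖ ^ 2) / σ
        = 1 / (2 * σ) * ‖y‖ ^ 2 - (‖y'‖ ^ 2 - 2 * ⟪y, y'⟫_ℝ + ‖y‖ ^ 2) / (2 * σ)
          + (⟪K x, y'⟫_ℝ + θ * ⟪K u, y'⟫_ℝ) - ‖y'‖ ^ 2 / (2 * σ) := by
      field_simp; ring
    linarith
  have hx2 : weight τ ωg * ‖x'‖ ^ 2 ≤ 1 / (2 * τ) * ‖x‖ ^ 2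
      - (‖x'‖ ^ 2 - 2 * ⟪x, x'⟫_ℝ + ‖x‖ ^ 2) / (2 * τ) - ⟪K x', y'⟫_ℝ := by
    have h1 := div_le_div_of_nonneg_right hx hτ.le
    have e1 : τ * ωg * ‖x'‖ ^ 2 / τ = weight τ ωg * ‖x'‖ ^ 2 - ‖x'‖ ^ 2 / (2 * τ) := by
      unfold weight; field_simp; ring
    have e2 : (⟪x, x'⟫_ℝ - τ * ⟪K x', y'⟫_ℝ - ‖x'‖ ^ 2) / τ
        = 1 / (2 * τ) * ‖x‖ ^ 2 - (‖x'‖ ^ 2 - 2 * ⟪x, x'⟫_ℝ + ‖x‖ ^ 2) / (2 * τ)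
          - ⟪K x', y'⟫_ℝ - ‖x'‖ ^ 2 / (2 * τ) := by
      field_simp; ring
    linarith [real_inner_comm (K x') y']
  linarith

/-- The properties shared by the primal updates of both algorithms. -/
structure IsPrimalUpdate (τ ωg : ℝ) (primal : Primal d → Primal d → Primal d) : Prop where
  monotone : ∀ v v' ξ, τ * ωg * ‖primal v ξ - primal v' ξ‖ ^ 2
    ≤ ⟪(v - v') - (primal v ξ - primal v' ξ), primal v ξ - primal v' ξ⟫_ℝ
  norm_sub_le : ∀ v ξ ξ', ‖primal v ξ - primal v ξ'‖ ≤ Real.sqrt (2 * τ) * ‖ξ - ξ'‖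
  continuous : Continuous fun p : Primal d × Primal d => primal p.1 p.2

lemma IsPotential.isPrimalUpdate_modified {g : Primal d → EReal} (hg : IsPotential g) {τ ωg : ℝ}
    (hω : IsStronglyConvex ωg g) (hτ : 0 < τ) :
    IsPrimalUpdate τ ωg fun v ξ => prox τ g (v + Real.sqrt (2 * τ) • ξ) where
  monotone v v' ξ := by
    have h := hg.prox_monotone hω hτ (v + Real.sqrt (2 * τ) • ξ) (v' + Real.sqrt (2 * τ) • ξ)
    rwa [add_sub_add_right_eq_sub] at h
  norm_sub_le v ξ ξ' := by
    refine (hg.norm_prox_sub_le hτ _ _).trans (le_of_eq ?_)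
    rw [add_sub_add_left_eq_sub, ← smul_sub, norm_smul, Real.norm_of_nonneg (Real.sqrt_nonneg _)]
  continuous := (hg.continuous_prox hτ).comp (by fun_prop)

lemma IsPotential.isPrimalUpdate_ulpda {g : Primal d → EReal} (hg : IsPotential g) {τ ωg : ℝ}
    (hω : IsStronglyConvex ωg g) (hτ : 0 < τ) :
    IsPrimalUpdate τ ωg fun v ξ => prox τ g v + Real.sqrt (2 * τ) • ξ where
  monotone v v' ξ := by
    rw [add_sub_add_right_eq_sub]
    exact hg.prox_monotone hω hτ v v'
  norm_sub_le v ξ ξ' := by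
    refine le_of_eq ?_
    rw [add_sub_add_left_eq_sub, ← smul_sub, norm_smul, Real.norm_of_nonneg (Real.sqrt_nonneg _)]
  continuous := ((hg.continuous_prox hτ).comp continuous_fst).add (by fun_prop)

lemma Admissible.energy_pdStep_le {K : Primal d →L[ℝ] Dual m} {τ σ θ ωg ωf : ℝ}
    (h : Admissible τ σ θ ωg ωf ‖K‖) {f : Dual m → EReal} (hf : IsPotential f)
    (hω : IsStronglyConvex ωf (conj f)) {primal : Primal d → Primal d → Primal d}
    (hp : IsPrimalUpdate τ ωg primal) (s s' : Primal d × Primal d × Dual m) (ξ : Primal d) :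
    energy K τ σ θ ωg ωf (pdStep primal f K τ σ θ s ξ - pdStep primal f K τ σ θ s' ξ)
      ≤ θ * energy K τ σ θ ωg ωf (s - s') := by
  have hθ := h.theta_pos
  have hfc := hf.isPotential_conj
  unfold energy
  simp only [pdStep, Prod.fst_sub, Prod.snd_sub]
  set y := prox σ (conj f) (s.2.2 + σ • K s.2.1)
  set y' := prox σ (conj f) (s'.2.2 + σ • K s'.2.1)
  set x := primal (s.1 - τ • (ContinuousLinearMap.adjoint K) y) ξ
  set x' := primal (s'.1 - τ • (ContinuousLinearMap.adjoint K) y') ξ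
  have e : θ⁻¹ • (x + θ • (x - s.1) - (x' + θ • (x' - s'.1)) - (x - x'))
      = (x - x') - (s.1 - s'.1) := by
    have e' : x + θ • (x - s.1) - (x' + θ • (x' - s'.1)) - (x - x')
      = θ • ((x - x') - (s.1 - s'.1)) := by module
    rw [e', inv_smul_smul₀ hθ.ne']
  rw [e]
  refine h.energy_decrease ?_ ?_
  · have h1 := hfc.prox_monotone hω h.sigma_pos (s.2.2 + σ • K s.2.1) (s'.2.2 + σ • K s'.2.1)
    rw [smul_inv_smul₀ hθ.ne', add_sub_cancel, map_sub]
    refine h1.trans (le_of_eq ?_)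
    congr 2
    module
  · have h1 := hp.monotone (s.1 - τ • (ContinuousLinearMap.adjoint K) y)
      (s'.1 - τ • (ContinuousLinearMap.adjoint K) y') ξ
    refine h1.trans (le_of_eq ?_)
    congr 2
    rw [map_sub]
    module

lemma continuous_pdStep {K : Primal d →L[ℝ] Dual m} {τ σ θ ωg : ℝ} {f : Dual m → EReal}
    (hf : IsPotential f) (hσ : 0 < σ) {primal : Primal d → Primal d → Primal d}
    (hp : IsPrimalUpdate τ ωg primal) :
    Continuous fun p : (Primal d × Primal d × Dual m) × Primal d =>
      pdStep primal f K τ σ θ p.1 p.2 := by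
  have hy : Continuous fun p : (Primal d × Primal d × Dual m) × Primal d =>
      prox σ (conj f) (p.1.2.2 + σ • K p.1.2.1) :=
    (hf.isPotential_conj.continuous_prox hσ).comp (by fun_prop)
  have hx : Continuous fun p : (Primal d × Primal d × Dual m) × Primal d =>
      primal (p.1.1 - τ • (ContinuousLinearMap.adjoint K)
        (prox σ (conj f) (p.1.2.2 + σ • K p.1.2.1))) p.2 :=
    hp.continuous.comp (f := fun p : (Primal d × Primal d × Dual m) × Primal d =>
      (p.1.1 - τ • (ContinuousLinearMap.adjoint K)
        (prox σ (conj f) (p.1.2.2 + σ • K p.1.2.1)), p.2)) (by fun_prop)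
  exact hx.prodMk ((hx.add ((hx.sub (by fun_prop)).const_smul θ)).prodMk hy)

lemma norm_pdStep_sub_le {K : Primal d →L[ℝ] Dual m} {τ σ θ ωg : ℝ} {f : Dual m → EReal}
    (hθ : 0 ≤ θ) {primal : Primal d → Primal d → Primal d} (hp : IsPrimalUpdate τ ωg primal)
    (s : Primal d × Primal d × Dual m) (ξ ξ' : Primal d) :
    ‖pdStep primal f K τ σ θ s ξ - pdStep primal f K τ σ θ s ξ'‖
      ≤ ((1 + θ) * Real.sqrt (2 * τ)) * ‖ξ - ξ'‖ := by
  simp only [pdStep, Prod.mk_sub_mk, sub_self]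
  set v := s.1 - τ • (ContinuousLinearMap.adjoint K) (prox σ (conj f) (s.2.2 + σ • K s.2.1))
  have h := hp.norm_sub_le v ξ ξ'
  have h0 : 0 ≤ Real.sqrt (2 * τ) * ‖ξ - ξ'‖ := by positivity
  have e : primal v ξ + θ • (primal v ξ - s.1) - (primal v ξ' + θ • (primal v ξ' - s.1))
    = (1 + θ) • (primal v ξ - primal v ξ') := by module
  rw [e, Prod.norm_mk, Prod.norm_mk, norm_smul, Real.norm_of_nonneg (by linarith), norm_zero,
    mul_assoc]
  refine max_le ?_ (max_le ?_ (by positivity))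
  · nlinarith
  · gcongr

end Energy

section NoiseSequences

variable {E : Type*} [MeasurableSpace E]

/-- The sequence with first term `p.1` and tail `p.2`. -/
def seqCons (p : E × (ℕ → E)) : ℕ → E
  | 0 => p.1
  | n + 1 => p.2 n

/-- The law of a sequence of independent random variables with law `γ`. -/
noncomputable def noiseLaw (γ : Measure E) : Measure (ℕ → E) := Measure.infinitePi fun _ => γ

instance (γ : Measure E) [IsProbabilityMeasure γ] : IsProbabilityMeasure (noiseLaw γ) := by
  unfold noiseLaw; infer_instance

lemma measurable_seqCons : Measurable (seqCons : E × (ℕ → E) → ℕ → E) := by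
  refine measurable_pi_lambda _ fun n => ?_
  cases n with
  | zero => exact measurable_fst
  | succ n => exact (measurable_pi_apply n).comp measurable_snd

lemma measurePreserving_eval_noiseLaw (γ : Measure E) [IsProbabilityMeasure γ] (n : ℕ) :
    MeasurePreserving (fun ξ : ℕ → E => ξ n) (noiseLaw γ) γ :=
  measurePreserving_eval_infinitePi (fun _ : ℕ => γ) n

lemma measurePreserving_seqCons (γ : Measure E) [IsProbabilityMeasure γ] :
    MeasurePreserving seqCons (γ.prod (noiseLaw γ)) (noiseLaw γ) := by
  refine ⟨measurable_seqCons, Measure.eq_infinitePi _ fun s t ht => ?_⟩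
  classical
  obtain ⟨N, hN⟩ : ∃ N, s ⊆ Finset.range (N + 1) :=
    ⟨s.sup id, fun i hi => Finset.mem_range_succ_iff.mpr (Finset.le_sup (f := id) hi)⟩
  set t' : ℕ → Set E := fun i => if i ∈ s then t i else Set.univ with ht'
  have hmt : ∀ i, MeasurableSet (t' i) := fun i => by
    rw [ht']; dsimp only; split_ifs; exacts [ht i, .univ]
  have hset : seqCons ⁻¹' ((s : Set ℕ).pi t) = t' 0 ×ˢ
      ((Finset.range N : Set ℕ).pi fun i => t' (i + 1)) := by
    ext p
    simp only [Set.mem_preimage, Set.mem_pi, Set.mem_prod, Finset.mem_coe, ht']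
    constructor
    · intro h
      refine ⟨?_, fun i _ => ?_⟩
      · split_ifs with h0
        exacts [h 0 h0, trivial]
      · split_ifs with h0
        exacts [h (i + 1) h0, trivial]
    · rintro ⟨h0, h1⟩ i hi
      cases i with
      | zero => rwa [if_pos hi] at h0
      | succ i =>
        have := h1 i (by have := Finset.mem_range.mp (hN hi); exact Finset.mem_range.mpr (by omega))
        rwa [if_pos hi] at this
  rw [Measure.map_apply measurable_seqCons (.pi s.countable_toSet fun i _ => ht i), hset,
    Measure.prod_prod, noiseLaw, Measure.infinitePi_pi _ (fun i _ => hmt (i + 1)), mul_comm,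
    ← Finset.prod_range_succ' (fun i => γ (t' i)) N, ← Finset.prod_subset hN]
  · exact Finset.prod_congr rfl fun i hi => by simp [ht', hi]
  · intro i _ hi
    simp [ht', hi]

end NoiseSequences

section Chain

variable {S E : Type*}

/-- The state after `n` steps, with the noise `ξ 0, ξ 1, …` used in this order. -/
def forwardIter (F : S → E → S) : ℕ → S → (ℕ → E) → S
  | 0, s, _ => s
  | n + 1, s, ξ => F (forwardIter F n s ξ) (ξ n)

/-- The state after `n` steps, with the noise `ξ (n - 1), …, ξ 0` used in this order. -/
def backwardIter (F : S → E → S) : ℕ → S → (ℕ → E) → S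
  | 0, s, _ => s
  | n + 1, s, ξ => backwardIter F n (F s (ξ n)) ξ

lemma forwardIter_seqCons (F : S → E → S) (n : ℕ) (s : S) (e : E) (ξ : ℕ → E) :
    forwardIter F (n + 1) s (seqCons (e, ξ)) = forwardIter F n (F s e) ξ := by
  induction n with
  | zero => rfl
  | succ n ih => rw [forwardIter, ih]; rfl

lemma backwardIter_seqCons (F : S → E → S) (n : ℕ) (s : S) (e : E) (ξ : ℕ → E) :
    backwardIter F (n + 1) s (seqCons (e, ξ)) = F (backwardIter F n s ξ) e := by
  induction n generalizing s with
  | zero => rfl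
  | succ n ih => rw [backwardIter, ih]; rfl

section Measurability

variable [MeasurableSpace S] [MeasurableSpace E]

lemma measurable_forwardIter {F : S → E → S} (hF : Measurable fun p : S × E => F p.1 p.2) (n : ℕ) :
    Measurable fun p : S × (ℕ → E) => forwardIter F n p.1 p.2 := by
  induction n with
  | zero => exact measurable_fst
  | succ n ih => exact hF.comp (ih.prodMk (by fun_prop))

lemma measurable_backwardIter {F : S → E → S} (hF : Measurable fun p : S × E => F p.1 p.2)
    (n : ℕ) : Measurable fun p : S × (ℕ → E) => backwardIter F n p.1 p.2 := by
  induction n with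
  | zero => exact measurable_fst
  | succ n ih =>
    exact ih.comp (f := fun p : S × (ℕ → E) => (F p.1 (p.2 n), p.2))
      ((hF.comp (f := fun p : S × (ℕ → E) => (p.1, p.2 n)) (by fun_prop)).prodMk measurable_snd)

lemma measurePreserving_forwardIter {F : S → E → S} {γ : Measure E} [IsProbabilityMeasure γ]
    {ρ : Measure S} [IsProbabilityMeasure ρ] (hF : Measurable fun p : S × E => F p.1 p.2)
    (hρ : (ρ.prod γ).map (fun p => F p.1 p.2) = ρ) (n : ℕ) :
    MeasurePreserving (fun p : S × (ℕ → E) => forwardIter F n p.1 p.2)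
      (ρ.prod (noiseLaw γ)) ρ := by
  induction n with
  | zero => exact measurePreserving_fst
  | succ n ih =>
    have h1 : MeasurePreserving
        (Prod.map (fun p : S × E => F p.1 p.2) (id : (ℕ → E) → (ℕ → E)))
        ((ρ.prod γ).prod (noiseLaw γ)) (ρ.prod (noiseLaw γ)) :=
      MeasurePreserving.prod ⟨hF, hρ⟩ (MeasurePreserving.id _)
    have h2 : MeasurePreserving
        (Prod.map (id : S → S) (seqCons : E × (ℕ → E) → ℕ → E) ∘ MeasurableEquiv.prodAssoc)
        ((ρ.prod γ).prod (noiseLaw γ)) (ρ.prod (noiseLaw γ)) :=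
      ((MeasurePreserving.id ρ).prod (measurePreserving_seqCons γ)).comp
        (measurePreserving_prodAssoc ρ γ (noiseLaw γ))
    have hm := measurable_forwardIter hF (n + 1)
    refine ⟨hm, Eq.trans ?_ (ih.comp h1).map_eq⟩
    rw [← h2.map_eq, Measure.map_map hm h2.measurable]
    congr 1
    ext p
    exact forwardIter_seqCons F n p.1.1 p.1.2 p.2

end Measurability

variable [NormedAddCommGroup S]

/-- The random map `F` contracts the quadratic functional `V` of the difference of two states. -/
structure IsContractive (F : S → E → S) (V : S → ℝ) (q c C : ℝ) : Prop where
  q_pos : 0 < q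
  q_lt_one : q < 1
  c_pos : 0 < c
  C_pos : 0 < C
  lower : ∀ s, c * ‖s‖ ^ 2 ≤ V s
  upper : ∀ s, V s ≤ C * ‖s‖ ^ 2
  contract : ∀ s s' e, V (F s e - F s' e) ≤ q * V (s - s')

lemma forwardIter_contract {F : S → E → S} {V : S → ℝ} {q : ℝ} (hq : 0 ≤ q)
    (h : ∀ s s' e, V (F s e - F s' e) ≤ q * V (s - s')) (n : ℕ) (s s' : S) (ξ : ℕ → E) :
    V (forwardIter F n s ξ - forwardIter F n s' ξ) ≤ q ^ n * V (s - s') := by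
  induction n with
  | zero => simp [forwardIter]
  | succ n ih =>
    refine (h _ _ _).trans ((mul_le_mul_of_nonneg_left ih hq).trans (le_of_eq ?_))
    ring

lemma backwardIter_contract {F : S → E → S} {V : S → ℝ} {q : ℝ} (hq : 0 ≤ q)
    (h : ∀ s s' e, V (F s e - F s' e) ≤ q * V (s - s')) (n : ℕ) (s s' : S) (ξ : ℕ → E) :
    V (backwardIter F n s ξ - backwardIter F n s' ξ) ≤ q ^ n * V (s - s') := by
  induction n generalizing s s' with
  | zero => simp [backwardIter]
  | succ n ih =>
    refine (ih _ _).trans ((mul_le_mul_of_nonneg_left (h _ _ _) (pow_nonneg hq n)).trans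
      (le_of_eq ?_))
    ring

lemma IsContractive.tendsto_forwardIter_sub {F : S → E → S} {V : S → ℝ} {q c C : ℝ}
    (h : IsContractive F V q c C) (s s' : S) (ξ : ℕ → E) :
    Tendsto (fun n => forwardIter F n s ξ - forwardIter F n s' ξ) atTop (𝓝 0) := by
  have hsq : Tendsto (fun n => ‖forwardIter F n s ξ - forwardIter F n s' ξ‖ ^ 2) atTop (𝓝 0) := by
    have hlim : Tendsto (fun n : ℕ => c⁻¹ * (q ^ n * V (s - s'))) atTop (𝓝 0) := by
      have := ((tendsto_pow_atTop_nhds_zero_of_lt_one h.q_pos.le h.q_lt_one).mul_const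
        (V (s - s'))).const_mul c⁻¹
      simpa using this
    refine squeeze_zero (fun n => sq_nonneg _) (fun n => ?_) hlim
    rw [← div_eq_inv_mul, le_div_iff₀' h.c_pos]
    exact (h.lower _).trans (forwardIter_contract h.q_pos.le h.contract n s s' ξ)
  rw [tendsto_zero_iff_norm_tendsto_zero]
  have := (Real.continuous_sqrt.tendsto 0).comp hsq
  simpa [Function.comp_def, Real.sqrt_sq (norm_nonneg _)] using this

lemma IsContractive.dist_backwardIter_succ_le {F : S → E → S} {V : S → ℝ} {q c C : ℝ}
    (h : IsContractive F V q c C) (n : ℕ) (ξ : ℕ → E) :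
    ‖backwardIter F (n + 1) 0 ξ - backwardIter F n 0 ξ‖ ^ 2
      ≤ C / c * (q ^ n * ‖F 0 (ξ n)‖ ^ 2) := by
  have h1 := backwardIter_contract h.q_pos.le h.contract n (F 0 (ξ n)) 0 ξ
  have h2 := (h.lower _).trans h1
  rw [sub_zero] at h2
  have h3 := mul_le_mul_of_nonneg_left (h.upper (F 0 (ξ n))) (pow_nonneg h.q_pos.le n)
  rw [div_mul_eq_mul_div, le_div_iff₀' h.c_pos]
  refine (h2.trans h3).trans (le_of_eq ?_)
  ring

variable [MeasurableSpace S] [BorelSpace S] [SecondCountableTopology S] [CompleteSpace S]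
  [MeasurableSpace E]

lemma IsContractive.invariant_unique [NormedSpace ℝ S] {F : S → E → S} {V : S → ℝ} {q c C : ℝ}
    (h : IsContractive F V q c C) {γ : Measure E} [IsProbabilityMeasure γ]
    (hF : Measurable fun p : S × E => F p.1 p.2) {ρ ρ' : Measure S} [IsProbabilityMeasure ρ]
    [IsProbabilityMeasure ρ'] (hρ : (ρ.prod γ).map (fun p => F p.1 p.2) = ρ)
    (hρ' : (ρ'.prod γ).map (fun p => F p.1 p.2) = ρ') : ρ = ρ' := by
  refine Measure.ext_of_charFunDual (funext fun L => ?_)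
  set M := (ρ.prod ρ').prod (noiseLaw γ) with hM
  set φ : S → ℂ := fun v => Complex.exp ((L v : ℂ) * Complex.I) with hφ
  have hφc : Continuous φ := by rw [hφ]; fun_prop
  have hφn : ∀ v, ‖φ v‖ = 1 := fun v => Complex.norm_exp_ofReal_mul_I _
  have hf1 : ∀ n, MeasurePreserving (fun p : (S × S) × (ℕ → E) => forwardIter F n p.1.1 p.2)
      M ρ := fun n =>
    (measurePreserving_forwardIter hF hρ n).comp
      (measurePreserving_fst.prod (MeasurePreserving.id (noiseLaw γ)))
  have hf2 : ∀ n, MeasurePreserving (fun p : (S × S) × (ℕ → E) => forwardIter F n p.1.2 p.2)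
      M ρ' := fun n =>
    (measurePreserving_forwardIter hF hρ' n).comp
      (measurePreserving_snd.prod (MeasurePreserving.id (noiseLaw γ)))
  have hi1 : ∀ n, Integrable
      (fun p : (S × S) × (ℕ → E) => φ (forwardIter F n p.1.1 p.2)) M := fun n =>
    Integrable.of_bound (hφc.measurable.comp (hf1 n).measurable).aestronglyMeasurable 1
      (ae_of_all _ fun p => (hφn _).le)
  have hi2 : ∀ n, Integrable
      (fun p : (S × S) × (ℕ → E) => φ (forwardIter F n p.1.2 p.2)) M := fun n =>
    Integrable.of_bound (hφc.measurable.comp (hf2 n).measurable).aestronglyMeasurable 1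
      (ae_of_all _ fun p => (hφn _).le)
  have hlim : Tendsto (fun n => ∫ p : (S × S) × (ℕ → E),
      (φ (forwardIter F n p.1.1 p.2) - φ (forwardIter F n p.1.2 p.2)) ∂M) atTop
      (𝓝 (∫ _ : (S × S) × (ℕ → E), (0 : ℂ) ∂M)) := by
    refine tendsto_integral_of_dominated_convergence (fun _ => 2)
      (fun n => ((hi1 n).sub (hi2 n)).aestronglyMeasurable) (integrable_const _)
      (fun n => ae_of_all _ fun p => ?_) (ae_of_all _ fun p => ?_)
    · refine (norm_sub_le _ _).trans ?_
      rw [hφn, hφn]; norm_num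
    · have h0 := h.tendsto_forwardIter_sub p.1.1 p.1.2 p.2
      rw [tendsto_zero_iff_norm_tendsto_zero]
      have h1 : Tendsto (fun n => ‖φ (forwardIter F n p.1.1 p.2 - forwardIter F n p.1.2 p.2) - 1‖)
          atTop (𝓝 ‖φ 0 - 1‖) :=
        (((hφc.sub continuous_const).norm).tendsto 0).comp h0
      have h2 : ‖φ 0 - 1‖ = 0 := by simp [hφ]
      rw [h2] at h1
      refine h1.congr fun n => ?_
      have e : φ (forwardIter F n p.1.1 p.2) - φ (forwardIter F n p.1.2 p.2)
          = φ (forwardIter F n p.1.2 p.2)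
            * (φ (forwardIter F n p.1.1 p.2 - forwardIter F n p.1.2 p.2) - 1) := by
        simp only [hφ, mul_sub, ← Complex.exp_add, map_sub]
        push_cast
        ring_nf
      rw [e, norm_mul, hφn, one_mul]
  have hconst : ∀ n, ∫ p : (S × S) × (ℕ → E),
      (φ (forwardIter F n p.1.1 p.2) - φ (forwardIter F n p.1.2 p.2)) ∂M
      = charFunDual ρ L - charFunDual ρ' L := fun n => by
    rw [integral_sub (hi1 n) (hi2 n), charFunDual_apply, charFunDual_apply]
    congr 1
    · rw [← (hf1 n).map_eq, integral_map (hf1 n).measurable.aemeasurable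
        (by exact hφc.aestronglyMeasurable)]
    · rw [← (hf2 n).map_eq, integral_map (hf2 n).measurable.aemeasurable
        (by exact hφc.aestronglyMeasurable)]
  simp only [hconst, integral_zero] at hlim
  exact sub_eq_zero.mp (tendsto_nhds_unique tendsto_const_nhds hlim)

lemma IsContractive.exists_backward_limit {F : S → E → S} {V : S → ℝ} {q c C : ℝ}
    (h : IsContractive F V q c C) {γ : Measure E} [IsProbabilityMeasure γ]
    (hF : Measurable fun p : S × E => F p.1 p.2) (hF0 : MemLp (fun e => F 0 e) 2 γ) :
    ∃ Z : (ℕ → E) → S, Measurable Z ∧ MemLp Z 2 (noiseLaw γ) ∧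
      ∀ᵐ ξ ∂noiseLaw γ, Tendsto (fun n => backwardIter F n 0 ξ) atTop (𝓝 (Z ξ)) := by
  set r := Real.sqrt q with hr
  have hr0 : 0 < r := Real.sqrt_pos.mpr h.q_pos
  have hr1 : r < 1 := by rw [hr, Real.sqrt_lt' one_pos]; simpa using h.q_lt_one
  have hrr : r * r = q := Real.mul_self_sqrt h.q_pos.le
  set u := Real.sqrt r with hu
  have hu0 : 0 < u := Real.sqrt_pos.mpr hr0
  have hu1 : u < 1 := by rw [hu, Real.sqrt_lt' one_pos]; simpa using hr1
  have huu : u * u = r := Real.mul_self_sqrt hr0.le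
  have hFm0 : Measurable fun e => F 0 e := hF.comp (by fun_prop : Measurable fun e : E => ((0 : S), e))
  have hmh : Measurable fun e => ENNReal.ofReal (‖F 0 e‖ ^ 2) := by fun_prop
  set H : (ℕ → E) → ℝ≥0∞ := fun ξ =>
    ∑' n, ENNReal.ofReal (r ^ n) * ENNReal.ofReal (‖F 0 (ξ n)‖ ^ 2) with hH
  have hterm : ∀ n, Measurable fun ξ : ℕ → E =>
      ENNReal.ofReal (r ^ n) * ENNReal.ofReal (‖F 0 (ξ n)‖ ^ 2) := fun n =>
    (hmh.comp (measurable_pi_apply n)).const_mul _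
  have hHm : Measurable H := Measurable.tsum hterm
  have hHi : ∫⁻ ξ, H ξ ∂noiseLaw γ ≠ ∞ := by
    rw [hH, lintegral_tsum fun n => (hterm n).aemeasurable]
    have e : ∀ n : ℕ, ∫⁻ ξ : ℕ → E, ENNReal.ofReal (r ^ n) * ENNReal.ofReal (‖F 0 (ξ n)‖ ^ 2)
        ∂noiseLaw γ = ENNReal.ofReal r ^ n * ∫⁻ e, ENNReal.ofReal (‖F 0 e‖ ^ 2) ∂γ := fun n => by
      rw [lintegral_const_mul' _ _ ENNReal.ofReal_ne_top, ENNReal.ofReal_pow hr0.le,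
        (measurePreserving_eval_noiseLaw γ n).lintegral_comp hmh]
    simp only [e]
    rw [ENNReal.tsum_mul_right, ENNReal.tsum_geometric]
    refine ENNReal.mul_ne_top ?_ ?_
    · rw [ENNReal.inv_ne_top]
      exact (tsub_pos_of_lt (ENNReal.ofReal_lt_one.mpr hr1)).ne'
    · have := (memLp_two_iff_integrable_sq_norm hF0.1).mp hF0
      exact this.lintegral_lt_top.ne
  have hstep : ∀ ξ, H ξ ≠ ∞ → ∀ n, dist (backwardIter F n 0 ξ) (backwardIter F (n + 1) 0 ξ)
      ≤ Real.sqrt (C / c * (H ξ).toReal) * u ^ n := fun ξ hξ n => by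
    rw [dist_eq_norm, norm_sub_rev]
    refine le_of_sq_le_sq ?_ (by positivity)
    have hCc : 0 ≤ C / c := (div_pos h.C_pos h.c_pos).le
    refine (h.dist_backwardIter_succ_le n ξ).trans ?_
    rw [mul_pow, Real.sq_sqrt (mul_nonneg hCc ENNReal.toReal_nonneg), mul_assoc]
    refine mul_le_mul_of_nonneg_left ?_ hCc
    have h1 : r ^ n * ‖F 0 (ξ n)‖ ^ 2 ≤ (H ξ).toReal := by
      rw [← ENNReal.ofReal_le_iff_le_toReal hξ, ENNReal.ofReal_mul (by positivity)]
      exact ENNReal.le_tsum (f := fun n => ENNReal.ofReal (r ^ n)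
        * ENNReal.ofReal (‖F 0 (ξ n)‖ ^ 2)) n
    have h2 := mul_le_mul_of_nonneg_right h1 (pow_nonneg hr0.le n)
    rw [← pow_mul, mul_comm n 2, pow_mul, pow_two u, huu]
    refine (le_of_eq ?_).trans h2
    rw [← hrr, mul_pow]; ring
  have hfin : ∀ᵐ ξ ∂noiseLaw γ, H ξ ≠ ∞ := by
    filter_upwards [ae_lt_top hHm hHi] with ξ hξ using hξ.ne
  obtain ⟨Z, hZm, hZ⟩ := measurable_limit_of_tendsto_metrizable_ae (μ := noiseLaw γ) (L := atTop)
    (f := fun n ξ => backwardIter F n 0 ξ)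
    (fun n => ((measurable_backwardIter hF n).comp
      (by fun_prop : Measurable fun ξ : ℕ → E => ((0 : S), ξ))).aemeasurable) (by
      filter_upwards [hfin] with ξ hξ
      exact cauchySeq_tendsto_of_complete (cauchySeq_of_le_geometric _ _ hu1 (hstep ξ hξ)))
  refine ⟨Z, hZm, ?_, hZ⟩
  rw [memLp_two_iff_integrable_sq_norm hZm.aestronglyMeasurable]
  refine Integrable.mono' ((integrable_toReal_of_lintegral_ne_top hHm.aemeasurable hHi).const_mul
    (C / c / (1 - u) ^ 2)) (by fun_prop) ?_
  filter_upwards [hfin, hZ] with ξ hξ hlim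
  have h1 := dist_le_of_le_geometric_of_tendsto₀ _ _ hu1 (hstep ξ hξ) hlim
  have h2 : ‖Z ξ‖ ≤ Real.sqrt (C / c * (H ξ).toReal) / (1 - u) := by
    rwa [backwardIter, dist_zero_left] at h1
  rw [Real.norm_of_nonneg (sq_nonneg _)]
  refine (pow_le_pow_left₀ (norm_nonneg _) h2 2).trans (le_of_eq ?_)
  rw [div_pow, Real.sq_sqrt (mul_nonneg (div_pos h.C_pos h.c_pos).le ENNReal.toReal_nonneg)]
  ring

lemma IsContractive.exists_invariant {F : S → E → S} {V : S → ℝ} {q c C : ℝ}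
    (h : IsContractive F V q c C) {γ : Measure E} [IsProbabilityMeasure γ]
    (hF : Measurable fun p : S × E => F p.1 p.2) (hFc : ∀ e, Continuous fun s => F s e)
    (hF0 : MemLp (fun e => F 0 e) 2 γ) :
    ∃ ρ : Measure S, IsProbabilityMeasure ρ ∧ (ρ.prod γ).map (fun p => F p.1 p.2) = ρ ∧
      MemLp id 2 ρ := by
  obtain ⟨Z, hZm, hZ2, hZ⟩ := h.exists_backward_limit hF hF0
  refine ⟨(noiseLaw γ).map Z, Measure.isProbabilityMeasure_map hZm.aemeasurable, ?_, ?_⟩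
  · have hcons := measurePreserving_seqCons γ
    have hae : (fun p : E × (ℕ → E) => F (Z p.2) p.1) =ᵐ[γ.prod (noiseLaw γ)]
        fun p => Z (seqCons p) := by
      filter_upwards [hcons.quasiMeasurePreserving.ae hZ,
        (measurePreserving_snd (μ := γ) (ν := noiseLaw γ)).quasiMeasurePreserving.ae hZ]
        with p hp1 hp2
      refine tendsto_nhds_unique ?_ (hp1.comp (tendsto_add_atTop_nat 1))
      exact (((hFc p.1).tendsto _).comp hp2).congr fun n =>
        (backwardIter_seqCons F n 0 p.1 p.2).symm
    have h1 : ((noiseLaw γ).map Z).prod γ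
        = (γ.prod (noiseLaw γ)).map fun p => (Z p.2, p.1) := by
      exact (((hZm.measurePreserving _).prod (MeasurePreserving.id γ)).comp
        Measure.measurePreserving_swap).map_eq.symm
    rw [h1, Measure.map_map hF (by fun_prop)]
    refine (Measure.map_congr hae).trans ?_
    rw [← Function.comp_def, ← Measure.map_map hZm hcons.measurable, hcons.map_eq]
  · rw [memLp_map_measure_iff aestronglyMeasurable_id hZm.aemeasurable]
    exact hZ2

end Chain

section TransportBounds

variable {A A' B Ξ : Type*} [MeasurableSpace A] [MeasurableSpace A'] [MeasurableSpace B]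
  [MeasurableSpace Ξ]

/-- Transporting a coupling of the initial values by the same noise. -/
lemma transportDist_map_prod_le [AddGroup B] (nrm : B → ℝ) {Φ : A → Ξ → B} {Φ' : A' → Ξ → B}
    (hΦ : Measurable fun p : A × Ξ => Φ p.1 p.2) (hΦ' : Measurable fun p : A' × Ξ => Φ' p.1 p.2)
    (M : Measure (A × A')) [IsFiniteMeasure M] (Q : Measure Ξ) [IsProbabilityMeasure Q] :
    transportDist nrm (((M.map Prod.fst).prod Q).map fun p => Φ p.1 p.2)
        (((M.map Prod.snd).prod Q).map fun p => Φ' p.1 p.2)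
      ≤ (∫⁻ p, ENNReal.ofReal (nrm (Φ p.1.1 p.2 - Φ' p.1.2 p.2) ^ 2) ∂M.prod Q) ^ (1 / 2 : ℝ) := by
  have h1 := (measurable_fst.measurePreserving M).prod (MeasurePreserving.id Q)
  have h2 := (measurable_snd.measurePreserving M).prod (MeasurePreserving.id Q)
  have hm1 : Measurable fun p : (A × A') × Ξ => Φ p.1.1 p.2 := hΦ.comp h1.measurable
  have hm2 : Measurable fun p : (A × A') × Ξ => Φ' p.1.2 p.2 := hΦ'.comp h2.measurable
  unfold transportDist
  refine ENNReal.rpow_le_rpow ?_ (by norm_num)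
  refine (iInf₂_le ((M.prod Q).map fun p => (Φ p.1.1 p.2, Φ' p.1.2 p.2)) ⟨?_, ?_⟩).trans
    (lintegral_map_le _ _)
  · rw [Measure.map_map measurable_fst (hm1.prodMk hm2), ← h1.map_eq,
      Measure.map_map hΦ h1.measurable]
    rfl
  · rw [Measure.map_map measurable_snd (hm1.prodMk hm2), ← h2.map_eq,
      Measure.map_map hΦ' h2.measurable]
    rfl

lemma transportDist_map_prod_le_mul [AddGroup A] [AddGroup B] {nrmA : A → ℝ} {nrmB : B → ℝ}
    {Φ : A → Ξ → B} (hΦ : Measurable fun p : A × Ξ => Φ p.1 p.2) {k : ℝ} (hk : 0 < k)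
    (hle : ∀ a a' ξ, nrmB (Φ a ξ - Φ a' ξ) ^ 2 ≤ k * nrmA (a - a') ^ 2)
    (hA : Measurable fun p : A × A => nrmA (p.1 - p.2))
    (μ μ' : Measure A) [IsFiniteMeasure μ] (Q : Measure Ξ) [IsProbabilityMeasure Q] :
    transportDist nrmB ((μ.prod Q).map fun p => Φ p.1 p.2) ((μ'.prod Q).map fun p => Φ p.1 p.2)
      ≤ ENNReal.ofReal (k ^ (1 / 2 : ℝ)) * transportDist nrmA μ μ' := by
  have hk' : ENNReal.ofReal k ≠ 0 := by simpa using hk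
  conv_rhs => unfold transportDist
  rw [← ENNReal.ofReal_rpow_of_nonneg hk.le (by norm_num),
    ← ENNReal.mul_rpow_of_nonneg _ _ (by norm_num)]
  rw [ENNReal.mul_iInf_of_ne hk' ENNReal.ofReal_ne_top]
  simp only [ENNReal.mul_iInf_of_ne hk' ENNReal.ofReal_ne_top]
  rw [one_div, ← ENNReal.rpow_inv_le_iff (by norm_num), inv_inv]
  refine le_iInf₂ fun M hM => ?_
  obtain ⟨rfl, rfl⟩ := hM
  have : IsFiniteMeasure M := ⟨by
    have := measure_lt_top (M.map Prod.fst) Set.univ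
    rwa [Measure.map_apply measurable_fst .univ] at this⟩
  have h := transportDist_map_prod_le nrmB hΦ hΦ M Q
  rw [one_div, ← ENNReal.rpow_inv_le_iff (by norm_num), inv_inv] at h
  refine h.trans ?_
  have hmA : Measurable fun p : A × A => ENNReal.ofReal (nrmA (p.1 - p.2) ^ 2) :=
    (hA.pow_const 2).ennreal_ofReal
  rw [← (measurePreserving_fst (μ := M) (ν := Q)).lintegral_comp hmA,
    ← lintegral_const_mul' _ _ ENNReal.ofReal_ne_top]
  refine lintegral_mono fun p => ?_
  rw [← ENNReal.ofReal_mul hk.le]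
  exact ENNReal.ofReal_le_ofReal (hle _ _ _)

end TransportBounds

section PrimalDual

variable {d m : ℕ}

/-- The initial state `(X⁰, X⁰, Y⁰)`. -/
def initState (z : Primal d × Dual m) : Primal d × Primal d × Dual m := (z.1, z.1, z.2)

/-- The primal-dual variable `(X, Y)` of a state. -/
def primalDual (s : Primal d × Primal d × Dual m) : Primal d × Dual m := (s.1, s.2.2)

lemma measurable_initState : Measurable (initState : Primal d × Dual m → _) := by
  unfold initState; fun_prop

lemma measurable_primalDual :
    Measurable (primalDual : Primal d × Primal d × Dual m → Primal d × Dual m) := by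
  unfold primalDual; fun_prop

lemma states_eq_forwardIter {Ω : Type*}
    (step : Primal d × Primal d × Dual m → Primal d → Primal d × Primal d × Dual m)
    (z₀ : Ω → Primal d × Dual m) (ξ : ℕ → Ω → Primal d) (n : ℕ) (w : Ω) :
    states step z₀ ξ n w = forwardIter step n (initState (z₀ w)) fun k => ξ k w := by
  induction n with
  | zero => rfl
  | succ n ih => rw [states, ih]; rfl

lemma IsInput.map_iterates {Ω : Type*} [MeasurableSpace Ω] {P : Measure Ω} [IsProbabilityMeasure P]
    {z₀ : Ω → Primal d × Dual m} {ξ : ℕ → Ω → Primal d} (h : IsInput P z₀ ξ)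
    {step : Primal d × Primal d × Dual m → Primal d → Primal d × Primal d × Dual m}
    (hstep : Measurable fun p : (Primal d × Primal d × Dual m) × Primal d => step p.1 p.2) (n : ℕ) :
    P.map (iterates step z₀ ξ n) = ((P.map z₀).prod (noiseLaw (stdGaussian (Primal d)))).map
      fun p => primalDual (forwardIter step n (initState p.1) p.2) := by
  have hξ : Measurable fun w n => ξ n w := measurable_pi_lambda _ h.measurable_noise
  have hlaw : P.map (fun w n => ξ n w) = noiseLaw (stdGaussian (Primal d)) := by
    rw [h.noise_indep.map_fun_eq_infinitePi_map h.measurable_noise]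
    simp only [h.noise_law]
    rfl
  have hm : Measurable fun p : (Primal d × Dual m) × (ℕ → Primal d) =>
      primalDual (forwardIter step n (initState p.1) p.2) :=
    measurable_primalDual.comp ((measurable_forwardIter hstep n).comp
      ((measurable_initState.comp measurable_fst).prodMk measurable_snd))
  rw [← hlaw, ← h.init_indep.map_prod_eq_prod_map_map h.measurable_init.aemeasurable
    hξ.aemeasurable, Measure.map_map hm (h.measurable_init.prodMk hξ)]
  congr 1
  ext1 w
  simp only [iterates, states_eq_forwardIter]
  rfl

lemma weightedNorm_one_sq {E F : Type*} [NormedAddCommGroup E] [NormedAddCommGroup F] {b : ℝ}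
    (hb : 0 ≤ b) (z : E × F) : weightedNorm 1 b z ^ 2 = ‖z.1‖ ^ 2 + b * ‖z.2‖ ^ 2 := by
  rw [weightedNorm, Real.sq_sqrt (by positivity), one_mul]

lemma measurable_weightedNorm_sub {b : ℝ} :
    Measurable fun p : (Primal d × Dual m) × (Primal d × Dual m) =>
      weightedNorm 1 b (p.1 - p.2) := by
  unfold weightedNorm; fun_prop

/-- The ratio of the weights of the dual and the primal variable. -/
noncomputable def weightRatio (τ σ ωg ωf : ℝ) : ℝ := weight σ ωf / weight τ ωg

variable {K : Primal d →L[ℝ] Dual m} {τ σ θ ωg ωf : ℝ}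

lemma Admissible.weightRatio_pos {L : ℝ} (h : Admissible τ σ θ ωg ωf L) :
    0 < weightRatio τ σ ωg ωf :=
  div_pos (weight_pos h.sigma_pos h.omega_f_nonneg) (weight_pos h.tau_pos h.omega_g_nonneg)

lemma Admissible.energy_initState_sub {L : ℝ} (h : Admissible τ σ θ ωg ωf L)
    (z z' : Primal d × Dual m) :
    energy K τ σ θ ωg ωf (initState z - initState z')
      = weight τ ωg * weightedNorm 1 (weightRatio τ σ ωg ωf) (z - z') ^ 2 := by
  have ha := weight_pos h.tau_pos h.omega_g_nonneg
  rw [weightedNorm_one_sq h.weightRatio_pos.le]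
  simp only [initState, Prod.mk_sub_mk, energy_diag, weightRatio, Prod.fst_sub, Prod.snd_sub]
  field_simp

lemma Admissible.weightedNorm_primalDual_sq_le (h : Admissible τ σ θ ωg ωf ‖K‖)
    (hlt : θ * σ * τ * ‖K‖ ^ 2 < 1) (s : Primal d × Primal d × Dual m) :
    weightedNorm 1 (weightRatio τ σ ωg ωf) (primalDual s) ^ 2
      ≤ (weight τ ωg * (1 - θ * σ * τ * ‖K‖ ^ 2))⁻¹ * energy K τ σ θ ωg ωf s := by
  have ha := weight_pos h.tau_pos h.omega_g_nonneg
  have hb := weight_pos h.sigma_pos h.omega_f_nonneg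
  rw [weightedNorm_one_sq h.weightRatio_pos.le, inv_mul_eq_div,
    le_div_iff₀ (mul_pos ha (by linarith))]
  refine le_trans (le_of_eq ?_) ((sub_le_self (b := weight τ ωg * (θ * σ * τ * ‖K‖ ^ 2)
    * ‖s.1‖ ^ 2) _ ?_).trans (h.le_energy s))
  · simp only [primalDual, weightRatio]
    field_simp
    ring
  · have := h.tau_pos
    have := h.sigma_pos
    have := h.theta_pos
    positivity

lemma Admissible.norm_fst_sq_le (h : Admissible τ σ θ ωg ωf ‖K‖)
    (s : Primal d × Primal d × Dual m) :
    ‖s.1‖ ^ 2 ≤ (weight τ ωg)⁻¹ * energy K τ σ θ ωg ωf s := by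
  have ha := weight_pos h.tau_pos h.omega_g_nonneg
  have hb := weight_pos h.sigma_pos h.omega_f_nonneg
  rw [inv_mul_eq_div, le_div_iff₀' ha]
  refine le_trans (le_add_of_nonneg_right ?_) (h.le_energy s)
  have : 0 ≤ 1 - θ * σ * τ * ‖K‖ ^ 2 := by linarith [h.coupling_le]
  positivity

lemma isContractive_pdStep (h : Admissible τ σ θ ωg ωf ‖K‖)
    (hθ1 : θ < 1) (hlt : θ * σ * τ * ‖K‖ ^ 2 < 1) {f : Dual m → EReal} (hf : IsPotential f)
    (hω : IsStronglyConvex ωf (conj f)) {primal : Primal d → Primal d → Primal d}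
    (hp : IsPrimalUpdate τ ωg primal) :
    ∃ c C, IsContractive (pdStep primal f K τ σ θ) (energy K τ σ θ ωg ωf) θ c C := by
  obtain ⟨c, hc, hlow⟩ := h.exists_norm_sq_le_energy hlt
  obtain ⟨C, hC, hup⟩ := h.exists_energy_le (K := K)
  exact ⟨c, C, h.theta_pos, hθ1, hc, hC, hlow, hup, h.energy_pdStep_le hf hω hp⟩

lemma IsPrimalUpdate.memLp_pdStep (hθ : 0 ≤ θ) {f : Dual m → EReal} (hf : IsPotential f)
    (hσ : 0 < σ) {primal : Primal d → Primal d → Primal d} (hp : IsPrimalUpdate τ ωg primal)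
    (s : Primal d × Primal d × Dual m) :
    MemLp (fun e => pdStep primal f K τ σ θ s e) 2 (stdGaussian (Primal d)) := by
  have hG : MemLp (fun e : Primal d => ‖e‖) 2 (stdGaussian (Primal d)) :=
    (IsGaussian.memLp_two_id (μ := stdGaussian (Primal d))).norm
  refine (((memLp_const ‖pdStep primal f K τ σ θ s 0‖).add
    (hG.const_mul ((1 + θ) * Real.sqrt (2 * τ))))).of_le ?_ (ae_of_all _ fun e => ?_)
  · exact ((continuous_pdStep hf hσ hp).comp
      (Continuous.prodMk_right s)).aestronglyMeasurable
  · have h1 := norm_pdStep_sub_le (K := K) (σ := σ) (f := f) hθ hp s e 0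
    rw [sub_zero] at h1
    have h2 := norm_sub_norm_le (pdStep primal f K τ σ θ s e) (pdStep primal f K τ σ θ s 0)
    refine le_trans ?_ (le_abs_self _)
    simp only [Pi.add_apply]
    linarith

/-- Existence, uniqueness and square integrability of the invariant law, and uniqueness of the
stationary distribution of the primal-dual variable. -/
lemma exists_invariant_pdStep (h : Admissible τ σ θ ωg ωf ‖K‖)
    (hθ1 : θ < 1) (hlt : θ * σ * τ * ‖K‖ ^ 2 < 1) {f : Dual m → EReal} (hf : IsPotential f)
    (hω : IsStronglyConvex ωf (conj f)) {primal : Primal d → Primal d → Primal d}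
    (hp : IsPrimalUpdate τ ωg primal) :
    ∃ ρ : Measure (Primal d × Primal d × Dual m), IsProbabilityMeasure ρ ∧
      (ρ.prod (stdGaussian (Primal d))).map (fun p => pdStep primal f K τ σ θ p.1 p.2) = ρ ∧
      MemLp id 2 ρ ∧
      ∀ ν, IsStationaryLaw (pdStep primal f K τ σ θ) ν ↔ ν = ρ.map primalDual := by
  obtain ⟨c, C, hcon⟩ := isContractive_pdStep h hθ1 hlt hf hω hp
  have hcont := continuous_pdStep (K := K) (θ := θ) hf h.sigma_pos hp
  obtain ⟨ρ, hρ, hinv, hmem⟩ := hcon.exists_invariant (γ := stdGaussian (Primal d))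
    hcont.measurable (fun e => hcont.comp (Continuous.prodMk_left e))
    (hp.memLp_pdStep h.theta_pos.le hf h.sigma_pos 0)
  refine ⟨ρ, hρ, hinv, hmem, fun ν => ⟨?_, ?_⟩⟩
  · rintro ⟨ρ', hρ', hinv', rfl⟩
    rw [hcon.invariant_unique hcont.measurable hinv hinv']
    rfl
  · rintro rfl
    exact ⟨ρ, hρ, hinv, rfl⟩

/-- Stability of the laws of the primal-dual chain in the transport distances. -/
lemma transport_stability (h : Admissible τ σ θ ωg ωf ‖K‖) {f : Dual m → EReal}
    (hf : IsPotential f) (hω : IsStronglyConvex ωf (conj f))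
    {primal : Primal d → Primal d → Primal d} (hp : IsPrimalUpdate τ ωg primal)
    {Ω : Type*} [MeasurableSpace Ω] {P : Measure Ω} [IsProbabilityMeasure P]
    {z₀ z₀' : Ω → Primal d × Dual m} {ξ : ℕ → Ω → Primal d} (hz : IsInput P z₀ ξ)
    (hz' : IsInput P z₀' ξ) (N : ℕ) :
    W2 ((P.map (iterates (pdStep primal f K τ σ θ) z₀ ξ N)).map Prod.fst)
        ((P.map (iterates (pdStep primal f K τ σ θ) z₀' ξ N)).map Prod.fst)
      ≤ ENNReal.ofReal ((θ ^ N) ^ (1 / 2 : ℝ))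
        * T 1 (weightRatio τ σ ωg ωf) (P.map z₀) (P.map z₀') ∧
    (θ * σ * τ * ‖K‖ ^ 2 < 1 →
      T 1 (weightRatio τ σ ωg ωf) (P.map (iterates (pdStep primal f K τ σ θ) z₀ ξ N))
        (P.map (iterates (pdStep primal f K τ σ θ) z₀' ξ N))
      ≤ ENNReal.ofReal (((1 - θ * σ * τ * ‖K‖ ^ 2)⁻¹ * θ ^ N) ^ (1 / 2 : ℝ))
        * T 1 (weightRatio τ σ ωg ωf) (P.map z₀) (P.map z₀')) := by
  have ha := weight_pos h.tau_pos h.omega_g_nonneg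
  have hθ := h.theta_pos
  have hstep := (continuous_pdStep (K := K) (θ := θ) hf h.sigma_pos hp).measurable
  have hm : Measurable fun p : (Primal d × Dual m) × (ℕ → Primal d) =>
      primalDual (forwardIter (pdStep primal f K τ σ θ) N (initState p.1) p.2) :=
    measurable_primalDual.comp ((measurable_forwardIter hstep N).comp
      ((measurable_initState.comp measurable_fst).prodMk measurable_snd))
  have hen : ∀ z z' : Primal d × Dual m, ∀ ξ : ℕ → Primal d,
      energy K τ σ θ ωg ωf (forwardIter (pdStep primal f K τ σ θ) N (initState z) ξ
        - forwardIter (pdStep primal f K τ σ θ) N (initState z') ξ)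
      ≤ θ ^ N * (weight τ ωg * weightedNorm 1 (weightRatio τ σ ωg ωf) (z - z') ^ 2) := by
    intro z z' ξ
    rw [← h.energy_initState_sub (K := K)]
    exact forwardIter_contract (V := energy K τ σ θ ωg ωf) hθ.le
      (h.energy_pdStep_le hf hω hp) N _ _ ξ
  rw [hz.map_iterates hstep, hz'.map_iterates hstep]
  constructor
  · rw [Measure.map_map measurable_fst hm, Measure.map_map measurable_fst hm]
    refine transportDist_map_prod_le_mul (B := Primal d) (Φ := fun z ξ =>
      (forwardIter (pdStep primal f K τ σ θ) N (initState z) ξ).1)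
      ((measurable_fst (α := Primal d) (β := Dual m)).comp hm)
      (pow_pos hθ N) (fun z z' ξ => ?_) measurable_weightedNorm_sub _ _ _
    have h1 := h.norm_fst_sq_le (forwardIter (pdStep primal f K τ σ θ) N (initState z) ξ
        - forwardIter (pdStep primal f K τ σ θ) N (initState z') ξ)
    refine h1.trans ?_
    rw [inv_mul_le_iff₀ ha]
    exact (hen z z' ξ).trans (le_of_eq (by ring))
  · intro hlt
    have hκ : 0 < 1 - θ * σ * τ * ‖K‖ ^ 2 := by linarith
    refine transportDist_map_prod_le_mul (Φ := fun z ξ => primalDual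
      (forwardIter (pdStep primal f K τ σ θ) N (initState z) ξ)) hm
      (by positivity) (fun z z' ξ => ?_) measurable_weightedNorm_sub _ _ _
    refine (h.weightedNorm_primalDual_sq_le hlt
      (forwardIter (pdStep primal f K τ σ θ) N (initState z) ξ
        - forwardIter (pdStep primal f K τ σ θ) N (initState z') ξ)).trans ?_
    rw [inv_mul_le_iff₀ (by positivity)]
    refine (hen z z' ξ).trans (le_of_eq ?_)
    field_simp

lemma tendsto_transport_stationary (h : Admissible τ σ θ ωg ωf ‖K‖)
    (hθ1 : θ < 1) (hlt : θ * σ * τ * ‖K‖ ^ 2 < 1) {f : Dual m → EReal} (hf : IsPotential f)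
    (hω : IsStronglyConvex ωf (conj f)) {primal : Primal d → Primal d → Primal d}
    (hp : IsPrimalUpdate τ ωg primal) {ρ : Measure (Primal d × Primal d × Dual m)}
    [IsProbabilityMeasure ρ]
    (hρ : (ρ.prod (stdGaussian (Primal d))).map (fun p => pdStep primal f K τ σ θ p.1 p.2) = ρ)
    (hρ2 : MemLp id 2 ρ) {Ω : Type*} [MeasurableSpace Ω] {P : Measure Ω} [IsProbabilityMeasure P]
    {z₀ : Ω → Primal d × Dual m} {ξ : ℕ → Ω → Primal d} (hz : IsInput P z₀ ξ)
    (hz2 : MemLp z₀ 2 P) :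
    Tendsto (fun N => T 1 (weightRatio τ σ ωg ωf)
      (P.map (iterates (pdStep primal f K τ σ θ) z₀ ξ N)) (ρ.map primalDual)) atTop (𝓝 0) := by
  have ha := weight_pos h.tau_pos h.omega_g_nonneg
  have hθ := h.theta_pos
  have hstep := (continuous_pdStep (K := K) (θ := θ) hf h.sigma_pos hp).measurable
  set M := (P.map z₀).prod ρ with hM
  have hprob : IsProbabilityMeasure (P.map z₀) :=
    Measure.isProbabilityMeasure_map hz.measurable_init.aemeasurable
  set k := (weight τ ωg * (1 - θ * σ * τ * ‖K‖ ^ 2))⁻¹ with hk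
  have hk0 : 0 < k := inv_pos.mpr (mul_pos ha (by linarith))
  set I := ∫⁻ p, ENNReal.ofReal (energy K τ σ θ ωg ωf (initState p.1 - p.2)) ∂M with hI
  have hIfin : I ≠ ∞ := by
    obtain ⟨C, hC, hup⟩ := h.exists_energy_le (K := K)
    have h1 : MemLp (fun p : (Primal d × Dual m) × (Primal d × Primal d × Dual m) =>
        initState p.1 - p.2) 2 M := by
      refine MemLp.sub ?_ (hρ2.comp_measurePreserving measurePreserving_snd)
      have h2 : MemLp (id : Primal d × Dual m → _) 2 (P.map z₀) := by
        rw [memLp_map_measure_iff aestronglyMeasurable_id hz.measurable_init.aemeasurable]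
        exact hz2
      refine (h2.comp_measurePreserving (measurePreserving_fst (ν := ρ))).of_le
        (measurable_initState.comp measurable_fst).aestronglyMeasurable (ae_of_all _ fun p => ?_)
      simp [initState, Prod.norm_def]
    have h3 := (((memLp_two_iff_integrable_sq_norm h1.1).mp h1).const_mul C).lintegral_lt_top
    refine ((lintegral_mono fun p => ENNReal.ofReal_le_ofReal (hup _)).trans_lt h3).ne
  have hbound : ∀ N : ℕ, T 1 (weightRatio τ σ ωg ωf)
      (P.map (iterates (pdStep primal f K τ σ θ) z₀ ξ N)) (ρ.map primalDual)
      ≤ (ENNReal.ofReal (k * θ ^ N) * I) ^ (1 / 2 : ℝ) := by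
    intro N
    have hinv := measurePreserving_forwardIter hstep hρ N
    have hm : Measurable fun p : (Primal d × Dual m) × (ℕ → Primal d) =>
        primalDual (forwardIter (pdStep primal f K τ σ θ) N (initState p.1) p.2) :=
      measurable_primalDual.comp ((measurable_forwardIter hstep N).comp
        ((measurable_initState.comp measurable_fst).prodMk measurable_snd))
    have hb := transportDist_map_prod_le (weightedNorm 1 (weightRatio τ σ ωg ωf))
      (Φ := fun z ξ => primalDual (forwardIter (pdStep primal f K τ σ θ) N (initState z) ξ)) hm
      (Φ' := fun s ξ => primalDual (forwardIter (pdStep primal f K τ σ θ) N s ξ))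
      (measurable_primalDual.comp hinv.measurable) M (noiseLaw (stdGaussian (Primal d)))
    rw [(measurePreserving_fst (μ := P.map z₀) (ν := ρ)).map_eq,
      (measurePreserving_snd (μ := P.map z₀) (ν := ρ)).map_eq, ← hz.map_iterates hstep,
      ← Function.comp_def primalDual, ← Measure.map_map measurable_primalDual hinv.measurable,
      hinv.map_eq] at hb
    refine hb.trans (ENNReal.rpow_le_rpow ?_ (by norm_num))
    have hmI : Measurable fun p : (Primal d × Dual m) × (Primal d × Primal d × Dual m) =>
        ENNReal.ofReal (energy K τ σ θ ωg ωf (initState p.1 - p.2)) :=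
      ((continuous_energy K τ σ θ ωg ωf).measurable.comp
        ((measurable_initState.comp measurable_fst).sub measurable_snd)).ennreal_ofReal
    rw [hI, ← (measurePreserving_fst (μ := M)
      (ν := noiseLaw (stdGaussian (Primal d)))).lintegral_comp hmI,
      ← lintegral_const_mul' _ _ ENNReal.ofReal_ne_top]
    refine lintegral_mono fun p => ?_
    rw [← ENNReal.ofReal_mul (by positivity)]
    refine ENNReal.ofReal_le_ofReal ?_
    refine (h.weightedNorm_primalDual_sq_le hlt
      (forwardIter (pdStep primal f K τ σ θ) N (initState p.1.1) p.2
        - forwardIter (pdStep primal f K τ σ θ) N p.1.2 p.2)).trans ?_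
    rw [← hk, mul_assoc]
    exact mul_le_mul_of_nonneg_left (forwardIter_contract (V := energy K τ σ θ ωg ωf) hθ.le
      (h.energy_pdStep_le hf hω hp) N _ _ p.2) hk0.le
  have hlim : Tendsto (fun N : ℕ => (ENNReal.ofReal (k * θ ^ N) * I) ^ (1 / 2 : ℝ)) atTop
      (𝓝 0) := by
    have h1 : Tendsto (fun N : ℕ => ENNReal.ofReal (k * θ ^ N)) atTop (𝓝 0) := by
      have := ((tendsto_pow_atTop_nhds_zero_of_lt_one hθ.le hθ1).const_mul k)
      rw [mul_zero] at this
      simpa using ENNReal.tendsto_ofReal this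
    have h2 := ENNReal.Tendsto.mul_const h1 (Or.inr hIfin)
    rw [zero_mul] at h2
    have h3 := ((ENNReal.continuous_rpow_const (y := (1 / 2 : ℝ))).tendsto 0).comp h2
    rwa [ENNReal.zero_rpow_of_pos (by norm_num)] at h3
  exact tendsto_of_tendsto_of_tendsto_of_le_of_le tendsto_const_nhds hlim
    (fun _ => zero_le) hbound

end PrimalDual

section Quadratic

variable {E : Type*} [NormedAddCommGroup E] [InnerProductSpace ℝ E]

/-- The potential `ω / 2 ‖x‖²`. -/
noncomputable def quadratic (ω : ℝ) (x : E) : EReal := ((ω / 2 * ‖x‖ ^ 2 : ℝ) : EReal)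

lemma norm_smul_add_smul_sq (x y : E) {a b : ℝ} (hab : a + b = 1) :
    ‖a • x + b • y‖ ^ 2 = a * ‖x‖ ^ 2 + b * ‖y‖ ^ 2 - a * b * ‖x - y‖ ^ 2 := by
  obtain rfl : b = 1 - a := by linarith
  rw [norm_add_sq_real, norm_sub_sq_real, norm_smul, norm_smul, mul_pow, mul_pow,
    real_inner_smul_left, real_inner_smul_right, Real.norm_eq_abs, Real.norm_eq_abs, sq_abs, sq_abs]
  ring

lemma isStronglyConvex_quadratic (ω : ℝ) : IsStronglyConvex ω (quadratic ω : E → EReal) := by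
  intro x y a b _ _ hab
  unfold quadratic
  norm_cast
  rw [norm_smul_add_smul_sq x y hab]
  exact le_of_eq (by ring)

lemma isPotential_quadratic {ω : ℝ} (hω : 0 ≤ ω) : IsPotential (quadratic ω : E → EReal) where
  ne_bot _ := EReal.coe_ne_bot _
  proper := ⟨0, EReal.coe_ne_top _⟩
  convex := by
    intro x y a b ha hb hab
    unfold quadratic
    norm_cast
    rw [norm_smul_add_smul_sq x y hab]
    have : 0 ≤ ω / 2 * (a * b * ‖x - y‖ ^ 2) := by positivity
    linarith
  lsc := (continuous_coe_real_ereal.comp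
    (by fun_prop : Continuous fun x : E => ω / 2 * ‖x‖ ^ 2)).lowerSemicontinuous

lemma conj_quadratic {ω : ℝ} (hω : 0 < ω) :
    conj (quadratic ω⁻¹ : E → EReal) = quadratic ω := by
  funext y
  refine le_antisymm (conj_le_iff.mpr fun x => ?_) ((le_of_eq ?_).trans (le_conj _ (ω • y) y))
  · unfold quadratic
    norm_cast
    have h1 : 0 ≤ ω⁻¹ / 2 * ‖x - ω • y‖ ^ 2 := by positivity
    rw [norm_sub_sq_real, real_inner_smul_right, norm_smul, Real.norm_of_nonneg hω.le] at h1
    have e : ω⁻¹ / 2 * (‖x‖ ^ 2 - 2 * (ω * ⟪x, y⟫_ℝ) + (ω * ‖y‖) ^ 2)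
        = ω⁻¹ / 2 * ‖x‖ ^ 2 - ⟪x, y⟫_ℝ + ω / 2 * ‖y‖ ^ 2 := by
      field_simp
    linarith
  · unfold quadratic
    norm_cast
    rw [real_inner_smul_left, real_inner_self_eq_norm_sq, norm_smul, Real.norm_of_nonneg hω.le]
    field_simp
    ring

lemma smul_mem_subdifferential_quadratic {ω : ℝ} (hω : 0 ≤ ω) (x : E) :
    ω • x ∈ subdifferential (quadratic ω) x := by
  intro y
  unfold quadratic
  norm_cast
  have h1 : 0 ≤ ω / 2 * ‖y - x‖ ^ 2 := by positivity
  rw [norm_sub_sq_real] at h1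
  rw [real_inner_smul_left, inner_sub_right, real_inner_self_eq_norm_sq, real_inner_comm]
  linarith

lemma prox_quadratic [FiniteDimensional ℝ E] {ω γ : ℝ} (hω : 0 ≤ ω) (hγ : 0 < γ) (z : E) :
    prox γ (quadratic ω) z = (1 + γ * ω)⁻¹ • z := by
  refine (isPotential_quadratic hω).prox_eq hγ (smul_mem_subdifferential_quadratic hω _) ?_
  have h : 1 + γ * ω ≠ 0 := by positivity
  conv_lhs => rw [← smul_inv_smul₀ h z]
  module

end Quadratic

section GaussianModel

variable {d m : ℕ}

lemma lintegral_exp_neg_quadratic_ne_zero (K : Primal d →L[ℝ] Dual m) (ω ω' : ℝ) :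
    (∫⁻ x : Primal d, EReal.exp (-(quadratic ω' (K x) + quadratic ω x))) ≠ 0 := by
  have hm : Measurable fun x : Primal d => EReal.exp (-(quadratic ω' (K x) + quadratic ω x)) := by
    simp only [quadratic, ← EReal.coe_add, ← EReal.coe_neg, EReal.exp_coe]
    fun_prop
  intro h
  rw [lintegral_eq_zero_iff hm] at h
  obtain ⟨x, hx⟩ := h.exists
  simp only [quadratic, ← EReal.coe_add, ← EReal.coe_neg, EReal.exp_coe, Pi.zero_apply,
    ENNReal.ofReal_eq_zero] at hx
  exact absurd hx (not_le.mpr (Real.exp_pos _))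

lemma lintegral_exp_neg_quadratic_ne_top (K : Primal d →L[ℝ] Dual m) {ω ω' : ℝ} (hω : 0 < ω)
    (hω' : 0 ≤ ω') :
    (∫⁻ x : Primal d, EReal.exp (-(quadratic ω' (K x) + quadratic ω x))) ≠ ∞ := by
  have hint : Integrable fun x : Primal d => Real.exp (-(ω / 2) * ‖x‖ ^ 2) := by
    refine Not.imp_symm integral_undef ?_
    rw [GaussianFourier.integral_rexp_neg_mul_sq_norm (by positivity)]
    positivity
  refine ne_top_of_le_ne_top hint.lintegral_lt_top.ne (lintegral_mono fun x => ?_)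
  simp only [quadratic, ← EReal.coe_add, ← EReal.coe_neg, EReal.exp_coe]
  refine ENNReal.ofReal_le_ofReal (Real.exp_le_exp.mpr ?_)
  have : 0 ≤ ω' / 2 * ‖K x‖ ^ 2 := by positivity
  linarith

lemma not_ae_eq_const_stdGaussian (hd : 0 < d) (a : Primal d) :
    ¬ ∀ᵐ ξ ∂stdGaussian (Primal d), ξ = a := by
  intro h
  set e : Primal d := EuclideanSpace.single ⟨0, hd⟩ 1 with he
  have h1 := variance_dual_stdGaussian (innerSL ℝ e)
  have h2 : Var[innerSL ℝ e; stdGaussian (Primal d)]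
      = Var[fun _ => innerSL ℝ e a; stdGaussian (Primal d)] :=
    variance_congr (by filter_upwards [h] with ξ hξ; rw [hξ])
  rw [h2] at h1
  simp [he, variance_eq_integral] at h1

variable {K : Primal d →L[ℝ] Dual m} {τ σ θ ωg ωf : ℝ}

/-- For quadratic potentials the modified step is conjugate to the unmodified step by a scaling. -/
lemma modifiedStep_smul_quadratic (hτ : 0 < τ) (hσ : 0 < σ) (hg : 0 ≤ ωg) (hf : 0 < ωf)
    (s : Primal d × Primal d × Dual m) (ξ : Primal d) :
    modifiedStep (quadratic ωf⁻¹) (quadratic ωg) K τ σ θ ((1 + τ * ωg)⁻¹ • s) ξ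
      = (1 + τ * ωg)⁻¹ • ulpdaStep (quadratic ωf⁻¹) (quadratic ωg) K τ σ θ s ξ := by
  set c := (1 + τ * ωg)⁻¹
  have hy : (1 + σ * ωf)⁻¹ • ((c • s).2.2 + σ • K (c • s).2.1)
      = c • (1 + σ * ωf)⁻¹ • (s.2.2 + σ • K s.2.1) := by
    simp only [Prod.smul_snd, Prod.smul_fst, map_smul]
    module
  simp only [modifiedStep, ulpdaStep, pdStep, conj_quadratic hf, prox_quadratic hf.le hσ,
    prox_quadratic hg hτ, hy]
  refine Prod.ext ?_ (Prod.ext ?_ rfl)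
  · simp only [Prod.smul_fst, map_smul]
    module
  · simp only [Prod.smul_fst, Prod.smul_snd, map_smul]
    module

lemma stationary_quadratic_ne (hd : 0 < d) (h : Admissible τ σ θ ωg ωf ‖K‖) (hg : 0 < ωg)
    (hf : 0 < ωf) {ρ : Measure (Primal d × Primal d × Dual m)} [IsProbabilityMeasure ρ]
    (hρ : (ρ.prod (stdGaussian (Primal d))).map
      (fun p => ulpdaStep (quadratic ωf⁻¹) (quadratic ωg) K τ σ θ p.1 p.2) = ρ)
    (hρ2 : MemLp id 2 ρ) :
    ρ.map primalDual ≠ (ρ.map ((1 + τ * ωg)⁻¹ • ·)).map primalDual := by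
  intro heq
  have hτ := h.tau_pos
  set c := (1 + τ * ωg)⁻¹ with hc
  have hc0 : 0 < c := by positivity
  have hc1 : c < 1 := inv_lt_one_of_one_lt₀ (by nlinarith [mul_pos hτ hg])
  have hsm : Measurable fun s : Primal d × Primal d × Dual m => c • s := measurable_const_smul c
  have hint : Integrable (fun s : Primal d × Primal d × Dual m => ‖s.1‖ ^ 2) ρ := by
    have h1 : MemLp (fun s : Primal d × Primal d × Dual m => s.1) 2 ρ :=
      hρ2.of_le measurable_fst.aestronglyMeasurable (ae_of_all _ fun s => norm_fst_le s)
    exact (memLp_two_iff_integrable_sq_norm h1.1).mp h1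
  have hzm : AEStronglyMeasurable (fun z : Primal d × Dual m => ‖z.1‖ ^ 2)
      (ρ.map primalDual) := by fun_prop
  have hI1 : ∫ z, ‖z.1‖ ^ 2 ∂(ρ.map primalDual) = ∫ s, ‖s.1‖ ^ 2 ∂ρ :=
    integral_map measurable_primalDual.aemeasurable hzm
  have hI2 : ∫ z, ‖z.1‖ ^ 2 ∂(ρ.map primalDual) = c ^ 2 * ∫ s, ‖s.1‖ ^ 2 ∂ρ := by
    rw [heq] at hzm ⊢
    rw [integral_map measurable_primalDual.aemeasurable hzm,
      integral_map hsm.aemeasurable (by unfold primalDual; fun_prop), ← integral_const_mul]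
    refine integral_congr_ae (ae_of_all _ fun s => ?_)
    simp only [primalDual, Prod.smul_fst, norm_smul, mul_pow, Real.norm_of_nonneg hc0.le]
  have hI0 : ∫ s : Primal d × Primal d × Dual m, ‖s.1‖ ^ 2 ∂ρ = 0 := by
    have h1 := hI1.symm.trans hI2
    have h2 : c ^ 2 < 1 := pow_lt_one₀ hc0.le hc1 two_ne_zero
    have h3 : (1 - c ^ 2) * ∫ s : Primal d × Primal d × Dual m, ‖s.1‖ ^ 2 ∂ρ = 0 := by linarith
    exact (mul_eq_zero.mp h3).resolve_left (by linarith)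
  rw [integral_eq_zero_iff_of_nonneg (fun s => sq_nonneg _) hint] at hI0
  have hfst : ∀ᵐ s ∂ρ, s.1 = 0 := by
    filter_upwards [hI0] with s hs
    simpa using hs
  have hprim := (isPotential_quadratic hg.le).isPrimalUpdate_ulpda
    (isStronglyConvex_quadratic (E := Primal d) ωg) hτ
  have hstep : Measurable fun p : (Primal d × Primal d × Dual m) × Primal d =>
      ulpdaStep (quadratic ωf⁻¹) (quadratic ωg) K τ σ θ p.1 p.2 :=
    (continuous_pdStep (isPotential_quadratic (inv_nonneg.mpr hf.le)) h.sigma_pos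
      hprim).measurable
  have hae := (MeasurePreserving.mk hstep hρ).quasiMeasurePreserving.ae hfst
  obtain ⟨s, hs⟩ := (Measure.ae_ae_of_ae_prod hae).exists
  set v := prox τ (quadratic ωg) (s.1 - τ • (ContinuousLinearMap.adjoint K)
    (prox σ (conj (quadratic ωf⁻¹)) (s.2.2 + σ • K s.2.1))) with hv
  refine not_ae_eq_const_stdGaussian hd (-(Real.sqrt (2 * τ))⁻¹ • v) ?_
  filter_upwards [hs] with ξ hξ
  have hξ' : v + Real.sqrt (2 * τ) • ξ = 0 := hξ
  have hr : Real.sqrt (2 * τ) ≠ 0 := (Real.sqrt_pos.mpr (by positivity)).ne'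
  rw [← inv_smul_smul₀ hr ξ, eq_neg_of_add_eq_zero_right hξ', neg_smul, smul_neg]

lemma exists_stationary_ne (hd : 0 < d) (h : Admissible τ σ θ ωg ωf ‖K‖) (hθ1 : θ < 1)
    (hlt : θ * σ * τ * ‖K‖ ^ 2 < 1) (hg : 0 < ωg) (hf : 0 < ωf) :
    ∃ πorig πmod : Measure (Primal d × Dual m),
      (∀ ν, IsStationaryLaw (ulpdaStep (quadratic ωf⁻¹) (quadratic ωg) K τ σ θ) ν ↔ ν = πorig) ∧
      (∀ ν, IsStationaryLaw (modifiedStep (quadratic ωf⁻¹) (quadratic ωg) K τ σ θ) ν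
        ↔ ν = πmod) ∧
      πorig ≠ πmod := by
  have hfp : IsPotential (quadratic ωf⁻¹ : Dual m → EReal) :=
    isPotential_quadratic (inv_nonneg.mpr hf.le)
  have hgp : IsPotential (quadratic ωg : Primal d → EReal) := isPotential_quadratic hg.le
  have hfs : IsStronglyConvex ωf (conj (quadratic ωf⁻¹ : Dual m → EReal)) := by
    rw [conj_quadratic hf]; exact isStronglyConvex_quadratic ωf
  have hpo := hgp.isPrimalUpdate_ulpda (isStronglyConvex_quadratic ωg) h.tau_pos
  have hpm := hgp.isPrimalUpdate_modified (isStronglyConvex_quadratic ωg) h.tau_pos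
  obtain ⟨ρ, hρ, hinv, hmem, huniq⟩ := exists_invariant_pdStep h hθ1 hlt hfp hfs hpo
  obtain ⟨ρ', -, -, -, huniq'⟩ := exists_invariant_pdStep h hθ1 hlt hfp hfs hpm
  refine ⟨ρ.map primalDual, ρ'.map primalDual, huniq, huniq', ?_⟩
  have hsm : Measurable fun s : Primal d × Primal d × Dual m => (1 + τ * ωg)⁻¹ • s :=
    measurable_const_smul _
  have hmo : Measurable fun p : (Primal d × Primal d × Dual m) × Primal d =>
      ulpdaStep (quadratic ωf⁻¹) (quadratic ωg) K τ σ θ p.1 p.2 :=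
    (continuous_pdStep (K := K) (θ := θ) hfp h.sigma_pos hpo).measurable
  have hmm : Measurable fun p : (Primal d × Primal d × Dual m) × Primal d =>
      modifiedStep (quadratic ωf⁻¹) (quadratic ωg) K τ σ θ p.1 p.2 :=
    (continuous_pdStep (K := K) (θ := θ) hfp h.sigma_pos hpm).measurable
  have hstat : IsStationaryLaw (modifiedStep (quadratic ωf⁻¹) (quadratic ωg) K τ σ θ)
      ((ρ.map ((1 + τ * ωg)⁻¹ • ·)).map primalDual) := by
    refine ⟨ρ.map ((1 + τ * ωg)⁻¹ • ·), Measure.isProbabilityMeasure_map hsm.aemeasurable, ?_, rfl⟩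
    have hprod := (hsm.measurePreserving ρ).prod (MeasurePreserving.id (stdGaussian (Primal d)))
    have hconj : (fun p : (Primal d × Primal d × Dual m) × Primal d =>
        modifiedStep (quadratic ωf⁻¹) (quadratic ωg) K τ σ θ p.1 p.2)
          ∘ Prod.map (fun s => (1 + τ * ωg)⁻¹ • s) id
        = (fun s => (1 + τ * ωg)⁻¹ • s) ∘ fun p : (Primal d × Primal d × Dual m) × Primal d =>
          ulpdaStep (quadratic ωf⁻¹) (quadratic ωg) K τ σ θ p.1 p.2 :=
      funext fun p => modifiedStep_smul_quadratic h.tau_pos h.sigma_pos hg.le hf p.1 p.2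
    rw [← hprod.map_eq, Measure.map_map hmm hprod.measurable, hconj,
      ← Measure.map_map hsm hmo]
    exact congrArg _ hinv
  rw [← (huniq' _).mp hstat]
  exact stationary_quadratic_ne hd h hg hf hinv hmem

end GaussianModel

section Parameters

variable {τ σ θ ωg ωf L : ℝ}

lemma admissible_of_max_le (hτ : 0 < τ) (hσ : 0 < σ) (hg : 0 < ωg) (hf : 0 < ωf)
    (hmax : max (1 + 2 * ωg * τ)⁻¹ (1 + 2 * ωf * σ)⁻¹ ≤ θ) (hθ : θ < 1)
    (hL : θ * σ * τ * L ^ 2 ≤ 1) : Admissible τ σ θ ωg ωf L where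
  tau_pos := hτ
  sigma_pos := hσ
  theta_pos := lt_of_lt_of_le (by positivity) ((le_max_left _ _).trans hmax)
  theta_le := hθ.le
  omega_g_nonneg := hg.le
  omega_f_nonneg := hf.le
  inv_g_le := (le_max_left _ _).trans hmax
  inv_f_le := (le_max_right _ _).trans hmax
  coupling_le := hL

lemma admissible_one (hτ : 0 < τ) (hσ : 0 < σ) (hL : τ * σ * L ^ 2 ≤ 1) :
    Admissible τ σ 1 0 0 L where
  tau_pos := hτ
  sigma_pos := hσ
  theta_pos := one_pos
  theta_le := le_rfl
  omega_g_nonneg := le_rfl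
  omega_f_nonneg := le_rfl
  inv_g_le := by simp
  inv_f_le := by simp
  coupling_le := by rwa [one_mul, mul_comm σ τ]

lemma Admissible.weightRatio_eq (h : Admissible τ σ θ ωg ωf L) :
    weightRatio τ σ ωg ωf = ((1 + 2 * ωg * τ) / (1 + 2 * ωf * σ) * (σ / τ))⁻¹ := by
  have hτ := h.tau_pos
  have hσ := h.sigma_pos
  have hg := h.omega_g_nonneg
  have hf := h.omega_f_nonneg
  unfold weightRatio weight
  field_simp

end Parameters

end ULPDA

theorem mainTheorem12 :
    -- stability for convex potentials, `θ = 1`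
    (∀ (d m : ℕ) (K : Primal d →L[ℝ] Dual m) (f : Dual m → EReal) (g : Primal d → EReal)
      (τ σ lam : ℝ),
      IsPotential f → IsPotential g → 0 < τ → 0 < σ → lam = σ / τ → τ * σ * ‖K‖ ^ 2 ≤ 1 →
      ∀ (Ω : Type*) [MeasurableSpace Ω] (P : Measure Ω) [IsProbabilityMeasure P]
        (z₀ z₀' : Ω → Primal d × Dual m) (ξ : ℕ → Ω → Primal d),
        IsInput P z₀ ξ → IsInput P z₀' ξ →
        ∀ π π' : ℕ → Measure (Primal d × Dual m),
          (∀ n, π n = P.map (iterates (modifiedStep f g K τ σ 1) z₀ ξ n)) →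
          (∀ n, π' n = P.map (iterates (modifiedStep f g K τ σ 1) z₀' ξ n)) →
          (∀ N, W2 ((π N).map Prod.fst) ((π' N).map Prod.fst) ≤ T 1 lam⁻¹ (π 0) (π' 0)) ∧
          (τ * σ * ‖K‖ ^ 2 < 1 → ∀ N, T 1 lam⁻¹ (π N) (π' N) ≤
            ENNReal.ofReal ((1 - τ * σ * ‖K‖ ^ 2) ^ (-(1 / 2) : ℝ)) *
              T 1 lam⁻¹ (π 0) (π' 0))) ∧
    -- contraction and convergence to a stationary distribution for strongly convex potentials
    (∀ (d m : ℕ) (K : Primal d →L[ℝ] Dual m) (f : Dual m → EReal) (g : Primal d → EReal)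
      (τ σ θ ωg ωf lam lam' : ℝ),
      IsPotential f → IsPotential g → 0 < τ → 0 < σ → 0 < ωg → 0 < ωf →
      IsStronglyConvex ωg g → IsStronglyConvex ωf (conj f) →
      max (1 + 2 * ωg * τ)⁻¹ (1 + 2 * ωf * σ)⁻¹ ≤ θ → θ < 1 → θ * σ * τ * ‖K‖ ^ 2 ≤ 1 →
      lam = σ / τ → lam' = (1 + 2 * ωg * τ) / (1 + 2 * ωf * σ) * lam →
      (∀ (Ω : Type*) [MeasurableSpace Ω] (P : Measure Ω) [IsProbabilityMeasure P]
        (z₀ z₀' : Ω → Primal d × Dual m) (ξ : ℕ → Ω → Primal d),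
        IsInput P z₀ ξ → IsInput P z₀' ξ →
        ∀ π π' : ℕ → Measure (Primal d × Dual m),
          (∀ n, π n = P.map (iterates (modifiedStep f g K τ σ θ) z₀ ξ n)) →
          (∀ n, π' n = P.map (iterates (modifiedStep f g K τ σ θ) z₀' ξ n)) →
          (∀ N : ℕ, W2 ((π N).map Prod.fst) ((π' N).map Prod.fst) ≤
            ENNReal.ofReal (θ ^ ((N : ℝ) / 2)) * T 1 lam'⁻¹ (π 0) (π' 0)) ∧
          (θ * σ * τ * ‖K‖ ^ 2 < 1 → ∀ N : ℕ, T 1 lam'⁻¹ (π N) (π' N) ≤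
            ENNReal.ofReal ((1 - θ * τ * σ * ‖K‖ ^ 2) ^ (-(1 / 2) : ℝ) * θ ^ ((N : ℝ) / 2)) *
              T 1 lam'⁻¹ (π 0) (π' 0))) ∧
      (θ * σ * τ * ‖K‖ ^ 2 < 1 →
        ∃ πs : Measure (Primal d × Dual m),
          (∀ ν, IsStationaryLaw (modifiedStep f g K τ σ θ) ν ↔ ν = πs) ∧ MemLp id 2 πs ∧
          ∀ (Ω : Type*) [MeasurableSpace Ω] (P : Measure Ω) [IsProbabilityMeasure P]
            (z₀ : Ω → Primal d × Dual m) (ξ : ℕ → Ω → Primal d),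
            IsInput P z₀ ξ → MemLp z₀ 2 P →
            Tendsto (fun N => T 1 lam'⁻¹
              (P.map (iterates (modifiedStep f g K τ σ θ) z₀ ξ N)) πs) atTop (𝓝 0))) ∧
    -- the stationary distribution may differ from that of the unmodified algorithm
    (∀ (d m : ℕ) (K : Primal d →L[ℝ] Dual m) (τ σ θ ωg ωf : ℝ),
      0 < d → 0 < τ → 0 < σ → 0 < ωg → 0 < ωf →
      max (1 + 2 * ωg * τ)⁻¹ (1 + 2 * ωf * σ)⁻¹ ≤ θ → θ < 1 → θ * σ * τ * ‖K‖ ^ 2 < 1 →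
      ∃ (f : Dual m → EReal) (g : Primal d → EReal),
        IsPotential f ∧ IsPotential g ∧ IsStronglyConvex ωg g ∧ IsStronglyConvex ωf (conj f) ∧
        (∫⁻ x, EReal.exp (-(f (K x) + g x))) ≠ 0 ∧ (∫⁻ x, EReal.exp (-(f (K x) + g x))) ≠ ∞ ∧
        ∃ πorig πmod : Measure (Primal d × Dual m),
          (∀ ν, IsStationaryLaw (ulpdaStep f g K τ σ θ) ν ↔ ν = πorig) ∧
          (∀ ν, IsStationaryLaw (modifiedStep f g K τ σ θ) ν ↔ ν = πmod) ∧
          πorig ≠ πmod) := by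
  refine ⟨?_, ?_, ?_⟩
  · rintro d m K f g τ σ lam hf hg hτ hσ rfl hL Ω _ P _ z₀ z₀' ξ hz hz' π π' hπ hπ'
    have h := admissible_one hτ hσ hL
    have hlam : (σ / τ)⁻¹ = weightRatio τ σ 0 0 := by rw [h.weightRatio_eq]; simp
    have h0 : π 0 = P.map z₀ := hπ 0
    have h0' : π' 0 = P.map z₀' := hπ' 0
    have key := fun N => transport_stability h hf
      hf.isPotential_conj.convex.isStronglyConvex_zero
      (hg.isPrimalUpdate_modified hg.convex.isStronglyConvex_zero hτ) hz hz' N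
    rw [hlam, h0, h0']
    refine ⟨fun N => ?_, fun hlt N => ?_⟩
    · rw [hπ, hπ']
      have h1 := (key N).1
      rw [one_pow, Real.one_rpow, ENNReal.ofReal_one, one_mul] at h1
      exact h1
    · rw [hπ, hπ']
      have e : 1 * σ * τ * ‖K‖ ^ 2 = τ * σ * ‖K‖ ^ 2 := by ring
      have h2 := (key N).2 (e ▸ hlt)
      rw [e, one_pow, mul_one, Real.inv_rpow (by linarith), ← Real.rpow_neg (by linarith)] at h2
      exact h2
  · rintro d m K f g τ σ θ ωg ωf lam lam' hf hg hτ hσ hωg hωf hgs hfs hmax hθ hL rfl rfl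
    have h := admissible_of_max_le hτ hσ hωg hωf hmax hθ hL
    have hp := hg.isPrimalUpdate_modified hgs hτ
    have hpow : ∀ N : ℕ, (θ ^ N) ^ (1 / 2 : ℝ) = θ ^ ((N : ℝ) / 2) := fun N => by
      rw [← Real.rpow_natCast, ← Real.rpow_mul h.theta_pos.le, mul_one_div]
    rw [← h.weightRatio_eq]
    refine ⟨?_, fun hlt => ?_⟩
    · intro Ω _ P _ z₀ z₀' ξ hz hz' π π' hπ hπ'
      have h0 : π 0 = P.map z₀ := hπ 0
      have h0' : π' 0 = P.map z₀' := hπ' 0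
      have key := fun N => transport_stability h hf hfs hp hz hz' N
      rw [h0, h0']
      refine ⟨fun N => ?_, fun hlt N => ?_⟩
      · rw [hπ, hπ', ← hpow]
        exact (key N).1
      · rw [hπ, hπ', ← hpow]
        have e : θ * τ * σ * ‖K‖ ^ 2 = θ * σ * τ * ‖K‖ ^ 2 := by ring
        have h2 := (key N).2 hlt
        rw [Real.mul_rpow (inv_nonneg.mpr (by linarith)) (pow_nonneg h.theta_pos.le N),
          Real.inv_rpow (by linarith), ← Real.rpow_neg (by linarith)] at h2
        rw [e]
        exact h2
    · obtain ⟨ρ, hρ, hinv, hmem, huniq⟩ := exists_invariant_pdStep h hθ hlt hf hfs hp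
      refine ⟨ρ.map primalDual, huniq, ?_, ?_⟩
      · rw [memLp_map_measure_iff aestronglyMeasurable_id measurable_primalDual.aemeasurable]
        refine hmem.of_le measurable_primalDual.aestronglyMeasurable (ae_of_all _ fun s => ?_)
        exact max_le (norm_fst_le s) ((norm_snd_le s.2).trans (norm_snd_le s))
      · intro Ω _ P _ z₀ ξ hz hz2
        exact tendsto_transport_stationary h hθ hlt hf hfs hp hinv hmem hz hz2
  · intro d m K τ σ θ ωg ωf hd hτ hσ hωg hωf hmax hθ hlt
    have h := admissible_of_max_le hτ hσ hωg hωf hmax hθ hlt.le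
    refine ⟨quadratic ωf⁻¹, quadratic ωg, isPotential_quadratic (inv_nonneg.mpr hωf.le),
      isPotential_quadratic hωg.le, isStronglyConvex_quadratic ωg, ?_,
      lintegral_exp_neg_quadratic_ne_zero K ωg ωf⁻¹,
      lintegral_exp_neg_quadratic_ne_top K hωg (inv_nonneg.mpr hωf.le),
      exists_stationary_ne hd h hθ hlt hωg hωf⟩
    rw [conj_quadratic hωf]
    exact isStronglyConvex_quadratic ωf
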